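/- Let $G=(V,E)$ be a finite simple graph, with a linear order fixed on $V$. For a vertex $i$ let $E(i)$ be the set of edges incident to $i$. Take one variable $x_z$ for each $z\in V\cup E$, and consider the polynomial $$\tilde P_G=\prod_{\{i,j\}\in E,\ i<j}\left(\Big(\sum_{e\in E(i)}x_e+x_i\Big)-\Big(\sum_{e\in E(j)}x_e+x_j\Big)\right)\in\mathbb{C}[x_z: z\in V\cup E].$$ The graph $G$ is called algebraic $(k,k')$-choosable if there is a function $K:V\cup E\to\{0,1,2,\dots\}$ with $\sum_{z\in V\cup E}K(z)=|E|$, with $K(i)<k$ for every vertex $i$ and $K(e)<k'$ for every edge $e$, such that the monomial $\prod_{z\in V\cup E}x_z^{K(z)}$ has a nonzero coefficient in $\tilde P_G$. (Reordering $V$ changes $\tilde P_G$ only by a sign, so this does not depend on the chosen order.) The graph $G$ is called nice if it has no isolated edge, that is, no edge that shares no end vertex with any other edge. Theorem. Every nice graph is algebraic $(1,6)$-choosable. -/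

import Mathlib

namespace TotalWeight

variable {V : Type*}

/-- `e` is an isolated edge of `G`: an edge that shares no end vertex with any other edge. -/
def IsIsolatedEdge (G : SimpleGraph V) (e : Sym2 V) : Prop :=
  e ∈ G.edgeSet ∧ ∀ f ∈ G.edgeSet, f ≠ e → ∀ v ∈ e, v ∉ f

/-- A graph is nice if it contains no isolated edges. -/
def IsNice (G : SimpleGraph V) : Prop :=
  ∀ e : Sym2 V, ¬ IsIsolatedEdge G e

noncomputable section

variable [Fintype V] [LinearOrder V] (G : SimpleGraph V) [DecidableRel G.Adj]

/-- The linear form `∑_{e ∈ E(i)} x_e + x_i`; the variables are indexed by the disjoint union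
of the vertex set and the edge set of `G`. -/
def vertexSum (i : V) : MvPolynomial (V ⊕ G.edgeSet) ℂ :=
  (∑ e : G.edgeSet with i ∈ e.1, MvPolynomial.X (Sum.inr e)) + MvPolynomial.X (Sum.inl i)

/-- The polynomial
`∏_{{i, j} ∈ E, i < j} ((∑_{e ∈ E(i)} x_e + x_i) - (∑_{e ∈ E(j)} x_e + x_j))`.
For an edge `e = {i, j}` with `i < j` we have `e.1.inf = i` and `e.1.sup = j`. -/
def totalPoly : MvPolynomial (V ⊕ G.edgeSet) ℂ :=
  ∏ e : G.edgeSet, (vertexSum G e.1.inf - vertexSum G e.1.sup)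

/-- `G` is algebraic total weight `(k, k')`-choosable: some monomial `x^K` with `∑ K = |E|`,
`K(i) < k` for each vertex `i` and `K(e) < k'` for each edge `e`
has a nonzero coefficient in `totalPoly G`. -/
def AlgebraicChoosable (k k' : ℕ) : Prop :=
  ∃ K : (V ⊕ G.edgeSet) →₀ ℕ,
    ∑ z, K z = G.edgeFinset.card ∧
    (∀ i : V, K (Sum.inl i) < k) ∧
    (∀ e : G.edgeSet, K (Sum.inr e) < k') ∧
    MvPolynomial.coeff K (totalPoly G) ≠ 0

end

end TotalWeight

/-! Setting the vertex variables to zero, the polynomial of the theorem arises from the product of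
x_i - x_j over the edges (`graphPoly`) by substituting for x_v the sum of the x_e over the edges e
at v. For the pairing that makes monomials orthogonal with norms K!, a linear substitution is
adjoint to its transpose (`apolar_aeval`). So it suffices to find a polynomial F in the edge
variables, of degree at most 5 in each, whose image under x_uv ↦ x_u + x_v pairs nontrivially with
the graph polynomial; some monomial of F then does. Multiplication is adjoint to differentiation, so
x_v^(deg v) deletes the vertex v, and F can be a product of factors that delete the graph piece by
piece (`Deletes`).

In a component C take a maximum independent set I. A homogeneous form in the variables of I deletes
I once its coefficient at the degree vector of I is nonzero (`exists_apolar_mul_graphPoly`). A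
product Φ of nonzero factors x_p ± x_q has coefficients symmetric about some c/2 up to sign, so the
coefficient of Φ² at c is, up to sign, a sum of squares (`IsPalindromic.coeff_mul_self_ne_zero`). To
make c the degree vector, each u outside I pairs its neighbours in I by x_p - x_q = (x_u + x_p) -
(x_u + x_q), and the vertices with a neighbour left over are paired by edge-disjoint paths, whose
alternating sums give x_u ± x_v. If their number is odd, niceness supplies one more linear factor
(`exists_single_form`).

The rest of C goes vertex by vertex, using (x_v + x_u) - (x_u + x_t) = x_v - x_t, where t is already
deleted and x_t therefore contributes nothing (`deletes_sdiff_of_tokens`). In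
`deletes_component_of_deletes` the uses of each edge add up to at most five. -/

namespace TotalWeight

open MvPolynomial Finset
open scoped Nat

set_option linter.unusedSectionVars false

/-! ### The apolar pairing and elimination of a variable. -/

section Apolar

variable {σ : Type*}

/-- The apolar pairing `⟨x^K, x^L⟩ = K! δ_{K,L}` of polynomials. -/
noncomputable def apolar :
    MvPolynomial σ ℚ →ₗ[ℚ] MvPolynomial σ ℚ →ₗ[ℚ] ℚ :=
  (basisMonomials σ ℚ).constr ℚ fun K => (K.prod fun _ n => (n ! : ℚ)) • lcoeff ℚ K

theorem apolar_monomial (K : σ →₀ ℕ) (Q : MvPolynomial σ ℚ) :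
    apolar (monomial K 1) Q = (K.prod fun _ n => (n ! : ℚ)) * coeff K Q := by
  have h := (basisMonomials σ ℚ).constr_basis ℚ
    (fun K => (K.prod fun _ n => (n ! : ℚ)) • lcoeff ℚ K) K
  rw [coe_basisMonomials] at h
  unfold apolar
  rw [h]
  rfl

theorem apolar_one (Q : MvPolynomial σ ℚ) : apolar 1 Q = coeff 0 Q := by
  have := apolar_monomial 0 Q
  simpa using this

theorem apolar_eq_sum (F Q : MvPolynomial σ ℚ) :
    apolar F Q = ∑ K ∈ F.support, coeff K F * ((K.prod fun _ n => (n ! : ℚ)) * coeff K Q) := by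
  conv_lhs => rw [F.as_sum]
  rw [map_sum, LinearMap.sum_apply]
  refine sum_congr rfl fun K _ => ?_
  have : (monomial K (coeff K F)) = coeff K F • monomial K (1 : ℚ) := by
    rw [smul_monomial, smul_eq_mul, mul_one]
  rw [this, map_smul, LinearMap.smul_apply, apolar_monomial, smul_eq_mul]

/-- The weight K! grows by the factor `K v + 1`, which is the factor that differentiation produces.
-/
theorem apolar_X_mul (v : σ) (F Q : MvPolynomial σ ℚ) :
    apolar (X v * F) Q = apolar F (pderiv v Q) := by
  classical
  induction F using MvPolynomial.induction_on' with
  | add p q hp hq => rw [mul_add, map_add, map_add, LinearMap.add_apply, LinearMap.add_apply, hp, hq]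
  | monomial K a =>
    have h1 : (monomial K a : MvPolynomial σ ℚ) = a • monomial K 1 := by
      rw [smul_monomial, smul_eq_mul, mul_one]
    rw [h1, mul_smul_comm, map_smul, map_smul, LinearMap.smul_apply, LinearMap.smul_apply]
    congr 1
    have h2 : (X v * monomial K 1 : MvPolynomial σ ℚ) = monomial (K + Finsupp.single v 1) 1 := by
      rw [X, monomial_mul, mul_one, add_comm]
    rw [h2, apolar_monomial, apolar_monomial, coeff_pderiv]
    have h3 : ((K + Finsupp.single v 1).prod fun _ n => (n ! : ℚ))
        = (K.prod fun _ n => (n ! : ℚ)) * (K v + 1) := by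
      have e1 : (K + Finsupp.single v 1).prod (fun _ n => (n ! : ℚ))
          = ∏ i ∈ insert v K.support, (((K + Finsupp.single v 1 : σ →₀ ℕ) i)! : ℚ) := by
        apply Finsupp.prod_of_support_subset
        · intro i hi
          by_cases hiv : i = v
          · simp [hiv]
          · have : K i ≠ 0 := by
              simpa [Finsupp.single_apply, Ne.symm hiv] using hi
            simp [this]
        · simp
      have e2 : K.prod (fun _ n => (n ! : ℚ)) = ∏ i ∈ insert v K.support, ((K i)! : ℚ) := by
        apply Finsupp.prod_of_support_subset
        · exact subset_insert _ _
        · simp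
      rw [e1, e2, ← mul_prod_erase _ _ (mem_insert_self v K.support),
        ← mul_prod_erase _ (fun i => ((K i)! : ℚ)) (mem_insert_self v K.support)]
      have e3 : ∏ i ∈ (insert v K.support).erase v, (((K + Finsupp.single v 1 : σ →₀ ℕ) i)! : ℚ)
          = ∏ i ∈ (insert v K.support).erase v, ((K i)! : ℚ) := by
        refine prod_congr rfl fun i hi => ?_
        have : v ≠ i := (ne_of_mem_erase hi).symm
        simp [this]
      rw [e3]
      simp [Nat.factorial_succ]
      ring
    rw [h3]
    ring

theorem pderiv_prod_X_sub_X [DecidableEq σ] {v : σ} {A : MvPolynomial σ ℚ} (hA : pderiv v A = 0)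
    (N : Finset σ) (hN : v ∉ N) :
    pderiv v ((∏ u ∈ N, (X v - X u)) * A) = ∑ w ∈ N, (∏ u ∈ N.erase w, (X v - X u)) * A := by
  induction N using Finset.induction_on with
  | empty => simp [hA]
  | insert a N ha ih =>
    have hav : a ≠ v := fun h => hN (by simp [h])
    have hvN : v ∉ N := fun h => hN (mem_insert_of_mem h)
    rw [prod_insert ha, mul_assoc, pderiv_mul, ih hvN, sum_insert ha, erase_insert ha]
    rw [map_sub, pderiv_X_self, pderiv_X_of_ne hav, sub_zero, one_mul, mul_sum]
    congr 1
    refine sum_congr rfl fun w hw => ?_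
    have haw : a ≠ w := fun h => ha (h ▸ hw)
    rw [erase_insert_of_ne haw, prod_insert (fun h => ha (mem_of_mem_erase h)), mul_assoc]

/-- Each power of `X v` acts as a derivative that removes one linear factor: n factors can go in n!
orders, and fewer than n run out. -/
theorem apolar_X_pow_mul [DecidableEq σ] {v : σ} {A : MvPolynomial σ ℚ} (hA : pderiv v A = 0)
    (n : ℕ) : ∀ (N : Finset σ), v ∉ N → ∀ F : MvPolynomial σ ℚ,
      (N.card = n → apolar (X v ^ n * F) ((∏ u ∈ N, (X v - X u)) * A) = n ! * apolar F A) ∧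
      (N.card < n → apolar (X v ^ n * F) ((∏ u ∈ N, (X v - X u)) * A) = 0) := by
  induction n with
  | zero =>
    intro N hN F
    refine ⟨fun h => ?_, fun h => absurd h (Nat.not_lt_zero _)⟩
    rw [card_eq_zero.mp h]
    simp
  | succ n ih =>
    intro N hN F
    have step : apolar (X v ^ (n + 1) * F) ((∏ u ∈ N, (X v - X u)) * A)
        = ∑ w ∈ N, apolar (X v ^ n * F) ((∏ u ∈ N.erase w, (X v - X u)) * A) := by
      rw [pow_succ', mul_assoc, apolar_X_mul, pderiv_prod_X_sub_X hA N hN, map_sum]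
    have hN' : ∀ w, v ∉ N.erase w := fun w h => hN (mem_of_mem_erase h)
    refine ⟨fun h => ?_, fun h => ?_⟩
    · rw [step, sum_congr rfl fun w hw => ((ih _ (hN' w) F).1 (by rw [card_erase_of_mem hw, h]; rfl)),
        sum_const, h, Nat.factorial_succ]
      push_cast
      rw [nsmul_eq_mul]
      push_cast
      ring
    · rw [step]
      refine sum_eq_zero fun w hw => ((ih _ (hN' w) F).2 ?_)
      rw [card_erase_of_mem hw]
      have := card_pos.mpr ⟨w, hw⟩
      omega

/-- Variables that do not occur in `Q` may be dropped from a product paired with `Q`. -/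
theorem apolar_prod_X_sub_X_mul {ι : Type*} {Q : MvPolynomial σ ℚ} (I : Finset ι) (v : σ) (p : ι → σ)
    (hp : ∀ i ∈ I, pderiv (p i) Q = 0) (F : MvPolynomial σ ℚ) :
    apolar ((∏ i ∈ I, (X v - X (p i))) * F) Q = apolar (X v ^ I.card * F) Q := by
  classical
  induction I using Finset.induction_on generalizing F with
  | empty => simp
  | insert a I ha ih =>
    have h1 := ih (fun i hi => hp i (mem_insert_of_mem hi)) ((X v - X (p a)) * F)
    rw [prod_insert ha, card_insert_of_notMem ha, pow_succ]
    have e1 : (X v - X (p a)) * (∏ i ∈ I, (X v - X (p i))) * F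
        = (∏ i ∈ I, (X v - X (p i))) * ((X v - X (p a)) * F) := by ring
    have e2 : X v ^ I.card * ((X v - X (p a)) * F)
        = X v ^ I.card * X v * F - X (p a) * (X v ^ I.card * F) := by ring
    rw [e1, h1, e2, map_sub, LinearMap.sub_apply, apolar_X_mul, hp a (mem_insert_self _ _), map_zero,
      sub_zero]

end Apolar

/-! ### Transposing linear substitutions. -/

section EdgeMap

variable {V E : Type*}

/-- Duality between a linear substitution and its transpose with respect to the apolar pairing. -/
theorem apolar_aeval [Fintype V] [Fintype E] (a : V → E → ℚ) (F : MvPolynomial E ℚ)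
    (Q : MvPolynomial V ℚ) :
    apolar F (aeval (fun v => ∑ e, C (a v e) * X e) Q)
      = apolar (aeval (fun e => ∑ v, C (a v e) * X v) F) Q := by
  classical
  have chain : ∀ (e : E) (Q : MvPolynomial V ℚ),
      pderiv e (aeval (fun v => ∑ e, C (a v e) * X e) Q : MvPolynomial E ℚ)
        = aeval (fun v => ∑ e, C (a v e) * X e) (∑ v, C (a v e) * pderiv v Q) := by
    intro e Q
    induction Q using MvPolynomial.induction_on with
    | C r => simp
    | add p q hp hq =>
      simp only [map_add, hp, hq, mul_add, sum_add_distrib]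
    | mul_X p v hp =>
      rw [map_mul, pderiv_mul, hp, aeval_X]
      have h1 : pderiv e (∑ e', C (a v e') * X e' : MvPolynomial E ℚ) = C (a v e) := by
        simp [pderiv_X, Pi.single_apply]
      have h2 : (∑ w, C (a w e) * pderiv w (p * X v) : MvPolynomial V ℚ)
          = (∑ w, C (a w e) * pderiv w p) * X v + p * C (a v e) := by
        simp only [pderiv_mul, pderiv_X, mul_add, sum_add_distrib, sum_mul]
        congr 1
        · exact sum_congr rfl fun w _ => by ring
        · simp [Pi.single_apply, mul_comm]
      rw [h1, h2]
      simp only [map_add, map_mul, aeval_X, algHom_C]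
      simp [algebraMap_eq]
  induction F using MvPolynomial.induction_on generalizing Q with
  | C r =>
    rw [algHom_C, algebraMap_eq]
    have h0 : coeff 0 (aeval (fun v => ∑ e, C (a v e) * X e) Q : MvPolynomial E ℚ) = coeff 0 Q := by
      induction Q using MvPolynomial.induction_on with
      | C r => simp [algebraMap_eq]
      | add p q hp hq => rw [map_add, coeff_add, coeff_add, hp, hq]
      | mul_X p v hp =>
        simp only [← constantCoeff_eq] at hp ⊢
        simp
    have e1 : apolar (C r : MvPolynomial E ℚ) = r • apolar 1 := by
      rw [← map_smul, smul_eq_C_mul, mul_one]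
    have e2 : apolar (C r : MvPolynomial V ℚ) = r • apolar 1 := by
      rw [← map_smul, smul_eq_C_mul, mul_one]
    rw [e1, e2, LinearMap.smul_apply, LinearMap.smul_apply, apolar_one, apolar_one, h0]
  | add p q hp hq => simp only [map_add, LinearMap.add_apply, hp, hq]
  | mul_X p e hp =>
    rw [mul_comm, apolar_X_mul, chain, hp, map_mul, aeval_X, map_sum, sum_mul, map_sum,
      LinearMap.sum_apply]
    refine sum_congr rfl fun v _ => ?_
    rw [mul_assoc, ← smul_eq_C_mul, ← smul_eq_C_mul, map_smul, map_smul, LinearMap.smul_apply, apolar_X_mul]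

end EdgeMap

/-! ### Polynomials with symmetric coefficients. -/

section Palindromic

variable {σ : Type*}

/-- A nonzero homogeneous polynomial whose coefficients at `α` and `c - α` agree up to a fixed
nonzero factor. -/
def IsPalindromic (c : σ →₀ ℕ) (Φ : MvPolynomial σ ℚ) : Prop :=
  Φ ≠ 0 ∧ (∃ n, Φ.IsHomogeneous n ∧ c.degree = 2 * n) ∧ (∀ α, coeff α Φ ≠ 0 → α ≤ c) ∧
    ∃ ε : ℚ, ε ≠ 0 ∧ ∀ α β, α + β = c → coeff α Φ = ε * coeff β Φ

theorem isPalindromic_one : IsPalindromic (0 : σ →₀ ℕ) 1 := by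
  classical
  refine ⟨one_ne_zero, ⟨0, isHomogeneous_one _ _, by simp⟩, fun α h => ?_, 1, one_ne_zero, ?_⟩
  · rw [coeff_one] at h
    by_contra h'
    exact h (if_neg fun h0 => h' h0.ge)
  · intro α β h
    obtain ⟨rfl, rfl⟩ := add_eq_zero.mp h
    simp

theorem eq_sum_antidiagonal [DecidableEq σ] {c : σ →₀ ℕ} {Φ : MvPolynomial σ ℚ}
    (h : ∀ α, coeff α Φ ≠ 0 → α ≤ c) :
    Φ = ∑ x ∈ antidiagonal c, monomial x.1 (coeff x.1 Φ) := by
  ext γ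
  rw [coeff_sum]
  simp only [coeff_monomial]
  by_cases hγ : γ ≤ c
  · rw [sum_eq_single (γ, c - γ)]
    · simp
    · rintro ⟨a, b⟩ hab hne
      rw [if_neg]
      rintro rfl
      apply hne
      rw [HasAntidiagonal.mem_antidiagonal] at hab
      simp only at hab
      rw [← hab, add_tsub_cancel_left]
    · intro hn
      exact absurd (HasAntidiagonal.mem_antidiagonal.mpr (add_tsub_cancel_of_le hγ)) hn
  · rw [sum_eq_zero]
    · by_contra h'
      exact hγ (h γ h')
    · rintro ⟨a, b⟩ hab
      rw [if_neg]
      rintro rfl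
      rw [HasAntidiagonal.mem_antidiagonal] at hab
      exact hγ (hab ▸ le_self_add)

theorem coeff_mul_eq_sum_antidiagonal [DecidableEq σ] {c c' : σ →₀ ℕ} {Φ Φ' : MvPolynomial σ ℚ}
    (h : ∀ α, coeff α Φ ≠ 0 → α ≤ c) (h' : ∀ α, coeff α Φ' ≠ 0 → α ≤ c') (γ : σ →₀ ℕ) :
    coeff γ (Φ * Φ') = ∑ x ∈ antidiagonal c, ∑ y ∈ antidiagonal c',
      if x.1 + y.1 = γ then coeff x.1 Φ * coeff y.1 Φ' else 0 := by
  conv_lhs => rw [eq_sum_antidiagonal h, eq_sum_antidiagonal h', sum_mul_sum]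
  rw [coeff_sum]
  refine sum_congr rfl fun x _ => ?_
  rw [coeff_sum]
  refine sum_congr rfl fun y _ => ?_
  rw [monomial_mul, coeff_monomial]

/-- The convolution sum is reindexed by passing to complements in both factors. -/
theorem IsPalindromic.mul {c c' : σ →₀ ℕ} {Φ Φ' : MvPolynomial σ ℚ}
    (h : IsPalindromic c Φ) (h' : IsPalindromic c' Φ') : IsPalindromic (c + c') (Φ * Φ') := by
  classical
  obtain ⟨h0, ⟨n, hn, hd⟩, hs, ε, hε, he⟩ := h
  obtain ⟨h0', ⟨n', hn', hd'⟩, hs', ε', hε', he'⟩ := h'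
  refine ⟨mul_ne_zero h0 h0', ⟨n + n', hn.mul hn', by rw [map_add, hd, hd']; ring⟩, ?_,
    ε * ε', mul_ne_zero hε hε', ?_⟩
  · intro α hα
    rw [coeff_mul_eq_sum_antidiagonal hs hs'] at hα
    obtain ⟨x, hx, hα⟩ := exists_ne_zero_of_sum_ne_zero hα
    obtain ⟨y, hy, hα⟩ := exists_ne_zero_of_sum_ne_zero hα
    rw [HasAntidiagonal.mem_antidiagonal] at hx hy
    split_ifs at hα with hxy
    · rw [← hxy, ← hx, ← hy]
      exact add_le_add le_self_add le_self_add
    · exact absurd rfl hα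
  · intro α β hαβ
    rw [coeff_mul_eq_sum_antidiagonal hs hs', coeff_mul_eq_sum_antidiagonal hs hs', mul_sum]
    refine sum_nbij' Prod.swap Prod.swap (fun x hx => (by
        rw [HasAntidiagonal.mem_antidiagonal] at hx ⊢; rw [← hx]; exact add_comm _ _))
      (fun x hx => (by
        rw [HasAntidiagonal.mem_antidiagonal] at hx ⊢; rw [← hx]; exact add_comm _ _)) (fun x _ => rfl) (fun x _ => rfl) fun x hx => ?_
    rw [mul_sum]
    refine sum_nbij' Prod.swap Prod.swap (fun x hx => (by
        rw [HasAntidiagonal.mem_antidiagonal] at hx ⊢; rw [← hx]; exact add_comm _ _))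
      (fun x hx => (by
        rw [HasAntidiagonal.mem_antidiagonal] at hx ⊢; rw [← hx]; exact add_comm _ _)) (fun x _ => rfl) (fun x _ => rfl) fun y hy => ?_
    rw [HasAntidiagonal.mem_antidiagonal] at hx hy
    have key : x.1 + y.1 = α ↔ x.2 + y.2 = β := by
      have e : (x.1 + y.1) + (x.2 + y.2) = α + β := by
        rw [hαβ, ← hx, ← hy, add_add_add_comm]
      constructor
      · intro h1
        rw [h1] at e
        exact add_left_cancel e
      · intro h1
        rw [h1] at e
        exact add_right_cancel e
    simp only [Prod.fst_swap, key]
    split_ifs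
    · rw [he _ _ hx, he' _ _ hy]
      ring
    · simp

/-- By symmetry the coefficient is ε times a sum of squares of rationals; this positivity is why the
argument runs over ℚ and not over ℂ. -/
theorem IsPalindromic.coeff_mul_self_ne_zero {c : σ →₀ ℕ} {Φ : MvPolynomial σ ℚ}
    (h : IsPalindromic c Φ) : coeff c (Φ * Φ) ≠ 0 := by
  classical
  obtain ⟨h0, -, hs, ε, hε, he⟩ := h
  have e1 : coeff c (Φ * Φ) = ε * ∑ x ∈ antidiagonal c, coeff x.2 Φ ^ 2 := by
    rw [coeff_mul, mul_sum]
    refine sum_congr rfl fun x hx => ?_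
    rw [he _ _ (HasAntidiagonal.mem_antidiagonal.mp hx)]
    ring
  rw [e1]
  refine mul_ne_zero hε (ne_of_gt ?_)
  obtain ⟨α, hα⟩ := ne_zero_iff.mp h0
  refine sum_pos' (fun x _ => sq_nonneg _) ⟨(c - α, α), ?_, ?_⟩
  · exact HasAntidiagonal.mem_antidiagonal.mpr (tsub_add_cancel_of_le (hs α hα))
  · exact sq_pos_of_ne_zero hα

/-- The hypothesis `h` excludes only the zero form x_a - x_a; the case 2 x_a is needed. -/
theorem isPalindromic_X_add_C_mul_X {a b : σ} {s : ℚ} (hs : s = 1 ∨ s = -1) (h : a ≠ b ∨ s = 1) :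
    IsPalindromic (Finsupp.single a 1 + Finsupp.single b 1) (X a + C s * X b) := by
  classical
  have hs2 : s * s = 1 := by rcases hs with rfl | rfl <;> norm_num
  have hco : ∀ α : σ →₀ ℕ, coeff α (X a + C s * X b : MvPolynomial σ ℚ)
      = (if Finsupp.single a 1 = α then 1 else 0) + s * (if Finsupp.single b 1 = α then 1 else 0) := by
    intro α
    rw [coeff_add, coeff_C_mul, coeff_X, coeff_X]
  refine ⟨?_, ⟨1, ?_, ?_⟩, ?_, s, ?_, ?_⟩
  · rw [ne_zero_iff]
    refine ⟨Finsupp.single a 1, ?_⟩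
    rw [hco, if_pos rfl]
    rcases h with h | rfl
    · rw [if_neg (fun h' => h ((Finsupp.single_left_injective one_ne_zero h').symm))]
      simp
    · split_ifs <;> norm_num
  · refine (isHomogeneous_X _ _).add ?_
    exact isHomogeneous_C_mul_X _ _
  · simp
  · intro α hα
    rw [hco] at hα
    split_ifs at hα with h1 h2 h2
    · rw [← h1]; exact le_self_add
    · rw [← h1]; exact le_self_add
    · rw [← h2]; exact le_add_self
    · simp at hα
  · rintro rfl
    simp at hs
  · intro α β hαβ
    have key : ∀ α β : σ →₀ ℕ, α + β = Finsupp.single a 1 + Finsupp.single b 1 →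
        Finsupp.single a 1 = α → Finsupp.single b 1 = β := by
      intro α β h1 h2
      rw [h2] at h1
      exact (add_left_cancel h1).symm
    have key' : ∀ α β : σ →₀ ℕ, α + β = Finsupp.single a 1 + Finsupp.single b 1 →
        Finsupp.single b 1 = β → Finsupp.single a 1 = α := by
      intro α β h1 h2
      rw [h2] at h1
      exact (add_right_cancel h1).symm
    have k1 : Finsupp.single a 1 = α ↔ Finsupp.single b 1 = β := ⟨key α β hαβ, key' α β hαβ⟩
    have hβα : β + α = Finsupp.single a 1 + Finsupp.single b 1 := by rw [add_comm, hαβ]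
    have k2 : Finsupp.single a 1 = β ↔ Finsupp.single b 1 = α := ⟨key β α hβα, key' β α hβα⟩
    rw [hco, hco]
    simp only [k1, k2]
    linear_combination (-(if Finsupp.single b 1 = β then (1 : ℚ) else 0)) * hs2

/-- The square of a palindromic polynomial, multiplied by one more signed sum of two variables. -/
theorem IsPalindromic.coeff_X_add_C_mul_X_mul_self_ne_zero {c : σ →₀ ℕ} {Φ : MvPolynomial σ ℚ}
    (hΦ : IsPalindromic c Φ) {a b : σ} {s : ℚ} (hs : s = 1 ∨ s = -1) (h : a ≠ b ∨ s = 1) :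
    coeff (Finsupp.single a 1 + c) ((X a + C s * X b) * (Φ * Φ)) ≠ 0 := by
  have hψ := isPalindromic_X_add_C_mul_X hs h
  have h1 := (hψ.mul hΦ).coeff_mul_self_ne_zero
  have hW := hψ.mul (hΦ.mul hΦ)
  obtain ⟨-, -, -, ε, hε, he⟩ := hW
  intro h0
  -- The two exponents are complementary for ψΦ², where ψ is the linear form, so both coefficients
  -- vanish. They combine to the central coefficient of (ψΦ)², which does not.
  have h2 : coeff (Finsupp.single b 1 + c) ((X a + C s * X b) * (Φ * Φ)) = 0 := by
    have := he (Finsupp.single a 1 + c) (Finsupp.single b 1 + c) (by abel)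
    rw [h0] at this
    simpa [hε] using this.symm
  apply h1
  have e1 : ((X a + C s * X b) * Φ * ((X a + C s * X b) * Φ) : MvPolynomial σ ℚ)
      = X a * ((X a + C s * X b) * (Φ * Φ)) + C s * (X b * ((X a + C s * X b) * (Φ * Φ))) := by ring
  have e2 : Finsupp.single a 1 + Finsupp.single b 1 + c
      = Finsupp.single a 1 + (Finsupp.single b 1 + c) := by abel
  have e3 : Finsupp.single a 1 + Finsupp.single b 1 + c
      = Finsupp.single b 1 + (Finsupp.single a 1 + c) := by abel
  rw [e1, coeff_add, coeff_C_mul]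
  nth_rewrite 1 [e2]
  rw [e3, coeff_X_mul, coeff_X_mul, h0, h2]
  simp

end Palindromic

/-! ### Deleting vertices by edge polynomials. -/

section Deletion

variable {V : Type*} [Fintype V] [LinearOrder V] (G : SimpleGraph V) [DecidableRel G.Adj]

/-- The graph polynomial of the subgraph induced by `S`. -/
noncomputable def graphPoly (S : Finset V) : MvPolynomial V ℚ :=
  ∏ e ∈ G.edgeFinset ∩ S.sym2, (X e.inf - X e.sup)

/-- The neighbours of `v` in `S`. -/
def nbrs (S : Finset V) (v : V) : Finset V := S.filter (G.Adj v)

variable {G} in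
theorem mem_nbrs {S : Finset V} {u v : V} : u ∈ nbrs G S v ↔ u ∈ S ∧ G.Adj v u := by
  simp [nbrs]

theorem pderiv_graphPoly {S : Finset V} {w : V} (hw : w ∉ S) : pderiv w (graphPoly G S) = 0 := by
  refine prod_induction _ (fun p => pderiv w p = 0) (fun a b ha hb => ?_) pderiv_one fun e he => ?_
  · rw [pderiv_mul, ha, hb, zero_mul, mul_zero, add_zero]
  · rw [mem_inter, mem_sym2_iff] at he
    induction e with
    | _ a b =>
      have ha : a ≠ w := fun h => hw (h ▸ he.2 a (by simp))
      have hb : b ≠ w := fun h => hw (h ▸ he.2 b (by simp))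
      rw [Sym2.inf_mk, Sym2.sup_mk, map_sub, pderiv_X_of_ne, pderiv_X_of_ne, sub_zero]
      · rcases max_choice a b with h | h <;> rw [h] <;> assumption
      · rcases min_choice a b with h | h <;> rw [h] <;> assumption

theorem graphPoly_eq_mul_erase {S : Finset V} {v : V} (hv : v ∈ S) :
    ∃ c : ℚ, c ≠ 0 ∧ graphPoly G S
      = C c * ((∏ u ∈ nbrs G S v, (X v - X u)) * graphPoly G (S.erase v)) := by
  have h1 : G.edgeFinset ∩ S.sym2
      = (nbrs G S v).image (fun u => s(v, u)) ∪ (G.edgeFinset ∩ (S.erase v).sym2) := by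
    ext e
    induction e with
    | _ a b =>
      simp only [mem_inter, SimpleGraph.mem_edgeFinset, SimpleGraph.mem_edgeSet, mk_mem_sym2_iff,
        mem_union, mem_image, mem_nbrs, Sym2.eq_iff, mem_erase]
      constructor
      · rintro ⟨hab, ha, hb⟩
        by_cases hav : a = v
        · subst hav
          exact Or.inl ⟨b, ⟨hb, hab⟩, Or.inl ⟨rfl, rfl⟩⟩
        · by_cases hbv : b = v
          · subst hbv
            exact Or.inl ⟨a, ⟨ha, hab.symm⟩, Or.inr ⟨rfl, rfl⟩⟩
          · exact Or.inr ⟨hab, ⟨hav, ha⟩, hbv, hb⟩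
      · rintro (⟨u, ⟨hu, huv⟩, ⟨rfl, rfl⟩ | ⟨rfl, rfl⟩⟩ | ⟨hab, ha, hb⟩)
        · exact ⟨huv, hv, hu⟩
        · exact ⟨huv.symm, hu, hv⟩
        · exact ⟨hab, ha.2, hb.2⟩
  have h2 : Disjoint ((nbrs G S v).image (fun u => s(v, u))) (G.edgeFinset ∩ (S.erase v).sym2) := by
    rw [disjoint_left]
    intro e he he'
    obtain ⟨u, -, rfl⟩ := mem_image.mp he
    have := (mk_mem_sym2_iff.mp (mem_inter.mp he').2).1
    simp at this
  have h3 : ∀ u, ∃ c : ℚ, c ≠ 0 ∧ (X (s(v, u)).inf - X (s(v, u)).sup : MvPolynomial V ℚ)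
      = C c * (X v - X u) := by
    intro u
    rcases le_total v u with h | h
    · exact ⟨1, one_ne_zero, by simp [h]⟩
    · exact ⟨-1, by norm_num, by simp [h]⟩
  choose c hc0 hc using h3
  refine ⟨∏ u ∈ nbrs G S v, c u, prod_ne_zero_iff.mpr fun u _ => hc0 u, ?_⟩
  rw [graphPoly, h1, prod_union h2, prod_image (fun a _ b _ h => Sym2.congr_right.mp h),
    prod_congr rfl fun u _ => hc u, prod_mul_distrib, map_prod, mul_assoc, graphPoly]

/-- Eliminating a vertex by a power of its variable. -/
theorem exists_apolar_X_pow_mul_graphPoly {S : Finset V} {v : V} (hv : v ∈ S) :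
    ∃ c : ℚ, c ≠ 0 ∧ ∀ F, apolar (X v ^ (nbrs G S v).card * F) (graphPoly G S)
      = c * apolar F (graphPoly G (S.erase v)) := by
  obtain ⟨c, hc, h⟩ := graphPoly_eq_mul_erase G hv
  refine ⟨c * (nbrs G S v).card !, mul_ne_zero hc (by positivity), fun F => ?_⟩
  have hA := pderiv_graphPoly G (notMem_erase v S)
  rw [h, ← smul_eq_C_mul, map_smul, (apolar_X_pow_mul hA _ _ (by simp [mem_nbrs]) F).1 rfl,
    smul_eq_mul, mul_assoc]

theorem apolar_X_pow_mul_graphPoly_eq_zero {S : Finset V} {v : V} (hv : v ∈ S) {n : ℕ}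
    (hn : (nbrs G S v).card < n) (F : MvPolynomial V ℚ) :
    apolar (X v ^ n * F) (graphPoly G S) = 0 := by
  obtain ⟨c, hc, h⟩ := graphPoly_eq_mul_erase G hv
  have hA := pderiv_graphPoly G (notMem_erase v S)
  rw [h, ← smul_eq_C_mul, map_smul, (apolar_X_pow_mul hA _ _ (by simp [mem_nbrs]) F).2 hn, smul_zero]

/-- The substitution that sends the variable of an edge to the sum of its end vertices. -/
noncomputable def edgeHom : MvPolynomial G.edgeSet ℚ →ₐ[ℚ] MvPolynomial V ℚ :=
  aeval fun e => ∑ v, C (if v ∈ e.1 then 1 else 0) * X v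

/-- The variable of the edge `uv`. -/
noncomputable def edgeVar (u v : V) : MvPolynomial G.edgeSet ℚ :=
  if h : s(u, v) ∈ G.edgeSet then X ⟨s(u, v), h⟩ else 0

variable {G} in
theorem edgeHom_edgeVar {u v : V} (h : G.Adj u v) : edgeHom G (edgeVar G u v) = X u + X v := by
  have h' : s(u, v) ∈ G.edgeSet := h
  rw [edgeVar, dif_pos h', edgeHom, aeval_X]
  have : ∀ w, (C (if w ∈ s(u, v) then 1 else 0) * X w : MvPolynomial V ℚ)
      = (if w = u then X w else 0) + (if w = v then X w else 0) := by
    intro w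
    have huv := h.ne
    by_cases h1 : w = u
    · subst h1
      simp [huv]
    · by_cases h2 : w = v
      · subst h2
        simp [h1]
      · simp [h1, h2]
  rw [sum_congr rfl fun w _ => this w, sum_add_distrib]
  simp

/-- The exponent of the variable of each edge `e` in `F` is at most `k e`. -/
def HasCost (k : Sym2 V → ℕ) (F : MvPolynomial G.edgeSet ℚ) : Prop :=
  ∀ e : G.edgeSet, F.degreeOf e ≤ k e

variable {G}

theorem HasCost.mono {k k' : Sym2 V → ℕ} {F : MvPolynomial G.edgeSet ℚ} (h : HasCost G k F)
    (hk : ∀ e ∈ G.edgeSet, k e ≤ k' e) : HasCost G k' F :=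
  fun e => (h e).trans (hk _ e.2)

theorem hasCost_one : HasCost G 0 1 := fun e => by simp

theorem HasCost.mul {k k' : Sym2 V → ℕ} {F F' : MvPolynomial G.edgeSet ℚ} (h : HasCost G k F)
    (h' : HasCost G k' F') : HasCost G (k + k') (F * F') :=
  fun e => (degreeOf_mul_le _ _ _).trans (add_le_add (h e) (h' e))

theorem HasCost.C_mul {k : Sym2 V → ℕ} {F : MvPolynomial G.edgeSet ℚ} (h : HasCost G k F) (r : ℚ) :
    HasCost G k (C r * F) :=
  fun e => (degreeOf_C_mul_le _ _ _).trans (h e)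

theorem HasCost.add {k k' : Sym2 V → ℕ} {F F' : MvPolynomial G.edgeSet ℚ} (h : HasCost G k F)
    (h' : HasCost G k' F') : HasCost G (k + k') (F + F') :=
  fun e => (degreeOf_add_le _ _ _).trans
    (max_le ((h e).trans (Nat.le_add_right _ _)) ((h' e).trans (Nat.le_add_left _ _)))

theorem HasCost.sub {k k' : Sym2 V → ℕ} {F F' : MvPolynomial G.edgeSet ℚ} (h : HasCost G k F)
    (h' : HasCost G k' F') : HasCost G (k + k') (F - F') := by
  have : F - F' = F + C (-1) * F' := by rw [C_neg, C_1]; ring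
  rw [this]
  exact h.add (h'.C_mul _)

theorem HasCost.prod {ι : Type*} (s : Finset ι) {k : ι → Sym2 V → ℕ}
    {F : ι → MvPolynomial G.edgeSet ℚ} (h : ∀ i ∈ s, HasCost G (k i) (F i)) :
    HasCost G (∑ i ∈ s, k i) (∏ i ∈ s, F i) := by
  classical
  induction s using Finset.induction_on with
  | empty => simpa using hasCost_one
  | insert a s ha ih =>
    rw [sum_insert ha, prod_insert ha]
    exact (h a (mem_insert_self _ _)).mul (ih fun i hi => h i (mem_insert_of_mem hi))

theorem hasCost_edgeVar (u v : V) : HasCost G (Pi.single s(u, v) 1) (edgeVar G u v) := by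
  intro e
  rw [edgeVar]
  split_ifs with h
  · rw [degreeOf_X]
    by_cases he : e = ⟨s(u, v), h⟩
    · subst he
      simp
    · simp [he]
  · simp

variable (G) in
/-- A polynomial in the edge variables, of exponents at most `k`, whose image under `edgeHom`
turns the graph polynomial of `S` into a nonzero multiple of the one of `S'`. -/
def Deletes (S S' : Finset V) (k : Sym2 V → ℕ) : Prop :=
  ∃ F, HasCost G k F ∧ ∃ c : ℚ, c ≠ 0 ∧ ∀ F', apolar (edgeHom G F * F') (graphPoly G S)
    = c * apolar F' (graphPoly G S')

theorem Deletes.mono {S S' : Finset V} {k k' : Sym2 V → ℕ} (h : Deletes G S S' k)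
    (hk : ∀ e ∈ G.edgeSet, k e ≤ k' e) : Deletes G S S' k' := by
  obtain ⟨F, hF, h⟩ := h
  exact ⟨F, hF.mono hk, h⟩

theorem deletes_refl (S : Finset V) : Deletes G S S 0 :=
  ⟨1, hasCost_one, 1, one_ne_zero, fun F' => by simp⟩

theorem Deletes.trans {S S' S'' : Finset V} {k k' : Sym2 V → ℕ} (h : Deletes G S S' k)
    (h' : Deletes G S' S'' k') : Deletes G S S'' (k + k') := by
  obtain ⟨F, hF, c, hc, h⟩ := h
  obtain ⟨F', hF', c', hc', h'⟩ := h'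
  refine ⟨F * F', hF.mul hF', c * c', mul_ne_zero hc hc', fun H => ?_⟩
  rw [map_mul (edgeHom G), mul_assoc, h, h', mul_assoc]

/-- Each neighbour `u` supplies the factor (x_v + x_u) - (x_u + x_{t u}) = x_v - x_{t u}. As `t u`
lies outside `S`, this acts like x_v, once for every neighbour. -/
theorem deletes_erase {S : Finset V} {v : V} (hv : v ∈ S) (t : V → V)
    (ht : ∀ u ∈ nbrs G S v, G.Adj u (t u) ∧ t u ∉ S) :
    Deletes G S (S.erase v)
      (∑ u ∈ nbrs G S v, (Pi.single s(v, u) 1 + Pi.single s(u, t u) 1)) := by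
  obtain ⟨c, hc, h⟩ := exists_apolar_X_pow_mul_graphPoly G hv
  refine ⟨∏ u ∈ nbrs G S v, (edgeVar G v u - edgeVar G u (t u)),
    HasCost.prod _ fun u _ => (hasCost_edgeVar v u).sub (hasCost_edgeVar u (t u)), c, hc, fun F => ?_⟩
  have e1 : edgeHom G (∏ u ∈ nbrs G S v, (edgeVar G v u - edgeVar G u (t u)))
      = ∏ u ∈ nbrs G S v, (X v - X (t u)) := by
    rw [map_prod]
    refine prod_congr rfl fun u hu => ?_
    rw [map_sub, edgeHom_edgeVar (mem_nbrs.mp hu).2, edgeHom_edgeVar (ht u hu).1]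
    ring
  rw [e1, apolar_prod_X_sub_X_mul _ _ _ (fun u hu => pderiv_graphPoly G (ht u hu).2), h]

theorem sum_single_star_le (N : Finset V) (v : V) (e : Sym2 V) :
    (∑ u ∈ N, Pi.single s(v, u) 1 : Sym2 V → ℕ) e = if ∃ u ∈ N, e = s(v, u) then 1 else 0 := by
  rw [Finset.sum_apply]
  split_ifs with h
  · obtain ⟨u, hu, rfl⟩ := h
    rw [sum_eq_single u]
    · simp
    · intro w _ hw
      have : s(v, u) ≠ s(v, w) := fun h => hw (Sym2.congr_right.mp h).symm
      simp [this]
    · exact fun h => absurd hu h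
  · refine sum_eq_zero fun u hu => ?_
    have : e ≠ s(v, u) := fun h' => h ⟨u, hu, h'⟩
    simp [this]

/-- Eliminating all vertices of `T`, when each of them but one has an edge leaving `S`. -/
theorem deletes_sdiff_of_tokens (n : ℕ) : ∀ (S T : Finset V) (t : V → V) (v : V), T.card = n →
    T ⊆ S → v ∈ T → (∀ u ∈ T, ∀ w ∈ S, G.Adj u w → w ∈ T) →
    (∀ u ∈ T, u ≠ v → G.Adj u (t u) ∧ t u ∉ S) →
    Deletes G S (S \ T) ((∑ u ∈ T.erase v, Pi.single s(u, t u) 1)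
      + fun e => if e ∈ T.sym2 then 2 else 0) := by
  induction n with
  | zero =>
    intro S T t v hT _ hv
    rw [card_eq_zero.mp hT] at hv
    simp at hv
  | succ n ih =>
    intro S T t v hT hTS hv hcl ht
    have hN : ∀ u ∈ nbrs G S v, u ∈ T.erase v := fun u hu =>
      mem_erase.mpr ⟨(mem_nbrs.mp hu).2.ne', hcl v hv u (mem_nbrs.mp hu).1 (mem_nbrs.mp hu).2⟩
    have h1 := deletes_erase (hTS hv) t fun u hu =>
      ht u (mem_of_mem_erase (hN u hu)) (ne_of_mem_erase (hN u hu))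
    have hstar : ∀ e, (∑ u ∈ nbrs G S v, Pi.single s(v, u) 1 : Sym2 V → ℕ) e
        + (if e ∈ (T.erase v).sym2 then 1 else 0) ≤ if e ∈ T.sym2 then 1 else 0 := by
      intro e
      rw [sum_single_star_le]
      by_cases he : ∃ u ∈ nbrs G S v, e = s(v, u)
      · rw [if_pos he]
        obtain ⟨u, hu, rfl⟩ := he
        have := mem_of_mem_erase (hN u hu)
        simp [hv, this]
      · rw [if_neg he]
        by_cases h' : e ∈ (T.erase v).sym2
        · rw [if_pos h', if_pos (sym2_mono (erase_subset _ _) h')]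
        · rw [if_neg h']
          simp
    by_cases hn : (T.erase v).Nonempty
    · obtain ⟨w, hw⟩ := hn
      -- A neighbour of `v` has spent its edge out of `S`, and its edge to the deleted `v` replaces
      -- it. An inner edge is thus charged at most twice: when its first end is deleted, and later
      -- as such a replacement.
      have h2 := ih (S.erase v) (T.erase v) (fun u => if G.Adj v u then v else t u) w
        (by rw [card_erase_of_mem hv, hT]; rfl) (erase_subset_erase _ hTS) hw
        (fun u hu x hx hux => mem_erase.mpr ⟨ne_of_mem_erase hx,
          hcl u (mem_of_mem_erase hu) x (mem_of_mem_erase hx) hux⟩)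
        (fun u hu _ => by
          split_ifs with huv
          · exact ⟨huv.symm, notMem_erase _ _⟩
          · obtain ⟨a, b⟩ := ht u (mem_of_mem_erase hu) (ne_of_mem_erase hu)
            exact ⟨a, fun h => b (mem_of_mem_erase h)⟩)
      have hS : (S.erase v) \ (T.erase v) = S \ T := by
        ext x
        simp only [mem_sdiff, mem_erase]
        constructor
        · rintro ⟨⟨a, b⟩, c⟩
          exact ⟨b, fun h => c ⟨a, h⟩⟩
        · rintro ⟨a, b⟩
          exact ⟨⟨fun h => b (h ▸ hv), a⟩, fun h => b h.2⟩
      rw [hS] at h2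
      refine (h1.trans h2).mono fun e _ => ?_
      have hle : (∑ u ∈ (T.erase v).erase w,
            Pi.single s(u, if G.Adj v u then v else t u) 1 : Sym2 V → ℕ) e
          ≤ (∑ u ∈ nbrs G S v, Pi.single s(v, u) 1 : Sym2 V → ℕ) e
            + ∑ u ∈ (T.erase v).filter (fun u => ¬ G.Adj v u),
              (Pi.single s(u, t u) 1 : Sym2 V → ℕ) e := by
        rw [Finset.sum_apply, Finset.sum_apply]
        refine (sum_le_sum_of_subset (erase_subset _ _)).trans ?_
        rw [← sum_filter_add_sum_filter_not _ (fun u => G.Adj v u)]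
        refine add_le_add ?_ ?_
        · refine (sum_le_sum_of_subset_of_nonneg (t := nbrs G S v) ?_ fun _ _ _ => Nat.zero_le _).trans
            (sum_le_sum fun u hu => ?_)
          · intro u hu
            rw [mem_filter, mem_erase] at hu
            exact mem_nbrs.mpr ⟨hTS hu.1.2, hu.2⟩
          · rw [if_pos (mem_nbrs.mp hu).2, Sym2.eq_swap]
        · refine sum_le_sum fun u hu => ?_
          rw [if_neg (mem_filter.mp hu).2]
      have hsplit : ∑ u ∈ nbrs G S v, (Pi.single s(u, t u) 1 : Sym2 V → ℕ) e
          + ∑ u ∈ (T.erase v).filter (fun u => ¬ G.Adj v u), (Pi.single s(u, t u) 1 : Sym2 V → ℕ) e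
          ≤ ∑ u ∈ T.erase v, (Pi.single s(u, t u) 1 : Sym2 V → ℕ) e := by
        rw [← sum_filter_add_sum_filter_not (T.erase v) (fun u => G.Adj v u)]
        refine add_le_add (sum_le_sum_of_subset fun u hu => ?_) le_rfl
        exact mem_filter.mpr ⟨hN u hu, (mem_nbrs.mp hu).2⟩
      have h3 := hstar e
      simp only [Pi.add_apply, sum_add_distrib, Finset.sum_apply] at hle hsplit h3 ⊢
      split_ifs at h3 ⊢ <;> omega
    · have hT1 : T.erase v = ∅ := not_nonempty_iff_eq_empty.mp hn
      have hS : S.erase v = S \ T := by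
        have : T = {v} := by
          rw [← insert_erase hv, hT1]
          rfl
        rw [this, sdiff_singleton_eq_erase]
      have hN0 : nbrs G S v = ∅ := by
        rw [eq_empty_iff_forall_notMem]
        intro u hu
        have := hN u hu
        rw [hT1] at this
        simp at this
      rw [hS, hN0] at h1
      exact h1.mono fun e _ => by simp

/-- The number of neighbours in `S` of each vertex of `I`. -/
noncomputable def degVec (G : SimpleGraph V) [DecidableRel G.Adj] (S I : Finset V) : V →₀ ℕ :=
  ∑ p ∈ I, Finsupp.single p (nbrs G S p).card

theorem degVec_apply {S I : Finset V} {p : V} (hp : p ∈ I) :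
    degVec G S I p = (nbrs G S p).card := by
  rw [degVec, Finsupp.finsetSum_apply, sum_eq_single p]
  · simp
  · intro q _ hq
    simp [hq]
  · exact fun h => absurd hp h

theorem monomial_eq_X_pow_mul (α : V →₀ ℕ) (v : V) :
    (monomial α 1 : MvPolynomial V ℚ) = X v ^ (α v) * monomial (α.erase v) 1 := by
  rw [X_pow_eq_monomial, monomial_mul, mul_one, Finsupp.single_add_erase]

/-- By independence, deleting one vertex of `I` leaves the degrees of the others unchanged. -/
theorem exists_apolar_monomial_degVec {S I : Finset V} (hI : I ⊆ S)
    (hind : ∀ p ∈ I, ∀ q ∈ I, ¬ G.Adj p q) :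
    ∃ c : ℚ, c ≠ 0 ∧ ∀ F, apolar (monomial (degVec G S I) 1 * F) (graphPoly G S)
      = c * apolar F (graphPoly G (S \ I)) := by
  induction I using Finset.induction_on with
  | empty => exact ⟨1, one_ne_zero, fun F => by simp [degVec]⟩
  | insert a I ha ih =>
    obtain ⟨c, hc, h⟩ := ih (fun x hx => hI (mem_insert_of_mem hx))
      (fun p hp q hq => hind p (mem_insert_of_mem hp) q (mem_insert_of_mem hq))
    have haS : a ∈ S \ I := mem_sdiff.mpr ⟨hI (mem_insert_self _ _), ha⟩
    obtain ⟨c', hc', h'⟩ := exists_apolar_X_pow_mul_graphPoly G haS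
    have e1 : nbrs G (S \ I) a = nbrs G S a := by
      ext u
      simp only [mem_nbrs, mem_sdiff]
      constructor
      · rintro ⟨⟨h1, _⟩, h2⟩
        exact ⟨h1, h2⟩
      · rintro ⟨h1, h2⟩
        exact ⟨⟨h1, fun h => hind a (mem_insert_self _ _) u (mem_insert_of_mem h) h2⟩, h2⟩
    have e2 : (S \ I).erase a = S \ insert a I := by
      ext x
      simp only [mem_erase, mem_sdiff, mem_insert]
      tauto
    rw [e1, e2] at h'
    refine ⟨c * c', mul_ne_zero hc hc', fun F => ?_⟩
    have e3 : (monomial (degVec G S (insert a I)) 1 : MvPolynomial V ℚ)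
        = monomial (degVec G S I) 1 * X a ^ (nbrs G S a).card := by
      rw [X_pow_eq_monomial, monomial_mul, mul_one, degVec, sum_insert ha, add_comm, degVec]
    rw [e3, mul_assoc, h, h', mul_assoc]

/-- A homogeneous polynomial in the variables of an independent set `I` deletes `I` if its
coefficient at the degree vector is nonzero. -/
theorem exists_apolar_mul_graphPoly {S I : Finset V} (hI : I ⊆ S)
    (hind : ∀ p ∈ I, ∀ q ∈ I, ¬ G.Adj p q) {F : MvPolynomial V ℚ}
    (hF : F.IsHomogeneous (degVec G S I).degree) (hs : ∀ α, coeff α F ≠ 0 → ∀ v, α v ≠ 0 → v ∈ I)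
    (h0 : coeff (degVec G S I) F ≠ 0) :
    ∃ c : ℚ, c ≠ 0 ∧ ∀ F', apolar (F * F') (graphPoly G S)
      = c * apolar F' (graphPoly G (S \ I)) := by
  obtain ⟨c, hc, h⟩ := exists_apolar_monomial_degVec hI hind
  refine ⟨coeff (degVec G S I) F * c, mul_ne_zero h0 hc, fun F' => ?_⟩
  have e1 : apolar (F * F') (graphPoly G S)
      = ∑ α ∈ F.support, coeff α F * apolar (monomial α 1 * F') (graphPoly G S) := by
    conv_lhs => rw [F.as_sum]
    rw [sum_mul, map_sum, LinearMap.sum_apply]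
    refine sum_congr rfl fun α _ => ?_
    have : (monomial α (coeff α F)) = coeff α F • monomial α (1 : ℚ) := by
      rw [smul_monomial, smul_eq_mul, mul_one]
    rw [this, smul_mul_assoc, map_smul, LinearMap.smul_apply, smul_eq_mul]
  rw [e1, sum_eq_single (degVec G S I)]
  · rw [h, mul_assoc]
  · intro α hα hne
    rw [mem_support_iff] at hα
    have hdeg : α.degree = (degVec G S I).degree := by
      by_contra hd
      exact hα (hF.coeff_eq_zero hd)
    -- Of two distinct exponents of equal total degree, each exceeds the other somewhere; there `α`
    -- differentiates too often.
    have : ∃ v, degVec G S I v < α v := by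
      by_contra hcon
      push Not at hcon
      apply hne
      have hle : α ≤ degVec G S I := hcon
      have h2 := congrArg Finsupp.degree (add_tsub_cancel_of_le hle)
      rw [map_add, hdeg] at h2
      have h3 : (degVec G S I - α).degree = 0 := by omega
      rw [Finsupp.degree_eq_zero_iff] at h3
      have h4 := add_tsub_cancel_of_le hle
      rw [h3, add_zero] at h4
      exact h4
    obtain ⟨v, hv⟩ := this
    have hvI : v ∈ I := hs α hα v (by omega)
    rw [degVec_apply hvI] at hv
    rw [monomial_eq_X_pow_mul α v, mul_assoc, apolar_X_pow_mul_graphPoly_eq_zero G (hI hvI) hv, mul_zero]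
  · intro h'
    rw [notMem_support_iff] at h'
    exact absurd h' h0

end Deletion

/-! ### Paths, pairings and palindromic forms from edge variables. -/

section Forms

variable {V : Type*} [Fintype V] [LinearOrder V] (G : SimpleGraph V) [DecidableRel G.Adj]

/-- `x_u ± x_v` is the image of a polynomial in the edge variables of exponents at most `k`. -/
def PathForm (k : Sym2 V → ℕ) (u v : V) : Prop :=
  ∃ F, HasCost G k F ∧ ∃ s : ℚ, (s = 1 ∨ s = -1) ∧ edgeHom G F = X u + C s * X v

/-- The set `R` is partitioned into pairs joined by path forms of total cost `k`. -/
inductive Joined : (Sym2 V → ℕ) → Finset V → Prop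
  | empty : Joined 0 ∅
  | pair {k k' : Sym2 V → ℕ} {u v : V} {R : Finset V} : u ∉ R → v ∉ R → u ≠ v →
      PathForm G k' u v → Joined k R → Joined (k' + k) (insert u (insert v R))

/-- `S` is obtained from the root `r` by successively adding adjacent vertices. -/
inductive Built {V : Type*} [DecidableEq V] (Γ : SimpleGraph V) (r : V) : Finset V → Prop
  | root : Built Γ r {r}
  | step {S : Finset V} {v q : V} : Built Γ r S → v ∉ S → q ∈ S → Γ.Adj v q →
      Built Γ r (insert v S)

variable {G}

theorem pathForm_of_adj {u v : V} (h : G.Adj u v) : PathForm G (Pi.single s(u, v) 1) u v :=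
  ⟨edgeVar G u v, hasCost_edgeVar u v, 1, Or.inl rfl, by rw [edgeHom_edgeVar h, C_1, one_mul]⟩

theorem PathForm.symm {k : Sym2 V → ℕ} {u v : V} (h : PathForm G k u v) : PathForm G k v u := by
  obtain ⟨F, hF, s, hs, h⟩ := h
  refine ⟨C s * F, hF.C_mul s, s, hs, ?_⟩
  have hs2 : (C s * C s : MvPolynomial V ℚ) = 1 := by
    rw [← C_mul, ← C_1]
    congr 1
    rcases hs with rfl | rfl <;> norm_num
  rw [map_mul, h, algHom_C, algebraMap_eq]
  linear_combination X v * hs2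

/-- Subtracting from the form of the new edge cancels x_u, so a path yields the alternating sum of
its edges. -/
theorem PathForm.cons {k : Sym2 V → ℕ} {u v w : V} (huv : G.Adj w u) (h : PathForm G k u v) :
    PathForm G (k + Pi.single s(w, u) 1) w v := by
  obtain ⟨F, hF, s, hs, h⟩ := h
  rw [add_comm]
  refine ⟨edgeVar G w u - F, (hasCost_edgeVar w u).sub hF, -s, ?_, ?_⟩
  · rcases hs with rfl | rfl
    · exact Or.inr rfl
    · exact Or.inl (neg_neg 1)
  · rw [map_sub, edgeHom_edgeVar huv, h, C_neg]
    ring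

/-- The path that ends in `q` is prolonged to `v`. -/
theorem Joined.replace {k : Sym2 V → ℕ} {R : Finset V} (h : Joined G k R) {q v : V} (hq : q ∈ R)
    (hv : v ∉ R) (hvq : G.Adj v q) :
    Joined G (k + Pi.single s(v, q) 1) (insert v (R.erase q)) := by
  induction h with
  | empty => simp at hq
  | @pair k k' a b R ha hb hab hp hJ ih =>
    simp only [mem_insert, not_or] at hv hq
    obtain ⟨hva, hvb, hvR⟩ := hv
    by_cases hqa : q = a
    · subst hqa
      have e : insert v ((insert q (insert b R)).erase q) = insert v (insert b R) := by
        rw [erase_insert (by simp [hab, ha])]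
      rw [e, add_right_comm]
      exact Joined.pair hvR hb hvb (hp.cons hvq) hJ
    · by_cases hqb : q = b
      · subst hqb
        have e : insert v ((insert a (insert q R)).erase q) = insert v (insert a R) := by
          rw [Finset.insert_comm, erase_insert (by simp [Ne.symm hab, hb])]
        rw [e, add_right_comm]
        exact Joined.pair hvR ha hva (hp.symm.cons hvq) hJ
      · have hqR : q ∈ R := by tauto
        have e : insert v ((insert a (insert b R)).erase q)
            = insert a (insert b (insert v (R.erase q))) := by
          rw [erase_insert_of_ne (Ne.symm hqa), erase_insert_of_ne (Ne.symm hqb), Finset.insert_comm v a,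
            Finset.insert_comm v b]
        rw [e, add_assoc]
        refine Joined.pair ?_ ?_ hab hp (ih hqR hvR)
        · simp [Ne.symm hva, ha]
        · simp [Ne.symm hvb, hb]

/-- In a connected graph every vertex set of even size can be paired up by edge-disjoint paths. -/
theorem Built.exists_joined {Γ : SimpleGraph V} (hΓ : Γ ≤ G) {r : V} {S : Finset V}
    (hS : Built Γ r S) : ∀ R ⊆ S, Even R.card → ∃ k, Joined G k R ∧ (∀ e, k e ≤ 1) ∧
      ∀ e, k e ≠ 0 → e ∈ Γ.edgeSet ∧ e ∈ S.sym2 := by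
  induction hS with
  | root =>
    intro R hR hcard
    rcases subset_singleton_iff.mp hR with rfl | rfl
    · exact ⟨0, Joined.empty, by simp, by simp⟩
    · simp at hcard
  | @step S v q hS hv hq hvq ih =>
    intro R hR hcard
    have hqv : q ≠ v := fun h => hv (h ▸ hq)
    have hnew : ∀ k : Sym2 V → ℕ, (∀ e, k e ≤ 1) → (∀ e, k e ≠ 0 → e ∈ Γ.edgeSet ∧ e ∈ S.sym2) →
        (∀ e, (k + Pi.single s(v, q) 1 : Sym2 V → ℕ) e ≤ 1) ∧
        ∀ e, (k + Pi.single s(v, q) 1 : Sym2 V → ℕ) e ≠ 0 →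
          e ∈ Γ.edgeSet ∧ e ∈ (insert v S).sym2 := by
      intro k h1 h2
      have h0 : k s(v, q) = 0 := by
        by_contra h
        exact hv (mk_mem_sym2_iff.mp (h2 _ h).2).1
      refine ⟨fun e => ?_, fun e he => ?_⟩
      · by_cases he : e = s(v, q)
        · subst he
          simp [h0]
        · simp [he, h1 e]
      · by_cases hevq : e = s(v, q)
        · subst hevq
          exact ⟨hvq, by simp [hq]⟩
        · have : k e ≠ 0 := by simpa [hevq] using he
          exact ⟨(h2 e this).1, sym2_mono (subset_insert _ _) (h2 e this).2⟩
    -- If `v` and `q` are both in `R`, the edge `vq` joins them. If only `v` is, `q` stands in for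
    -- it and its path is prolonged to `v`. Otherwise the new edge stays unused.
    by_cases hvR : v ∈ R
    · have hsub : R.erase v ⊆ S := fun x hx => by
        rcases mem_insert.mp (hR (mem_of_mem_erase hx)) with h | h
        · exact absurd h (ne_of_mem_erase hx)
        · exact h
      have hc := card_erase_add_one hvR
      by_cases hqR : q ∈ R
      · have hqR' : q ∈ R.erase v := mem_erase.mpr ⟨hqv, hqR⟩
        have hc' := card_erase_add_one hqR'
        obtain ⟨k, hJ, h1, h2⟩ := ih ((R.erase v).erase q) ((erase_subset _ _).trans hsub) (by
          rw [Nat.even_iff] at hcard ⊢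
          omega)
        refine ⟨k + Pi.single s(v, q) 1, ?_, hnew k h1 h2⟩
        have e : R = insert v (insert q ((R.erase v).erase q)) := by
          rw [insert_erase hqR', insert_erase hvR]
        rw [e, add_comm]
        refine Joined.pair ?_ ?_ hqv.symm (pathForm_of_adj (hΓ hvq)) hJ
        · simp
        · simp
      · have hqR' : q ∉ R.erase v := fun h => hqR (mem_of_mem_erase h)
        obtain ⟨k, hJ, h1, h2⟩ := ih (insert q (R.erase v)) (insert_subset hq hsub) (by
          rw [card_insert_of_notMem hqR']
          rwa [hc])
        refine ⟨k + Pi.single s(v, q) 1, ?_, hnew k h1 h2⟩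
        have := hJ.replace (mem_insert_self _ _) (by simp [hqv.symm]) (hΓ hvq)
        rwa [erase_insert hqR', insert_erase hvR] at this
    · have hsub : R ⊆ S := fun x hx => by
        rcases mem_insert.mp (hR hx) with h | h
        · exact absurd (h ▸ hx) hvR
        · exact h
      obtain ⟨k, hJ, h1, h2⟩ := ih R hsub hcard
      exact ⟨k, hJ, h1, fun e he => ⟨(h2 e he).1, sym2_mono (subset_insert _ _) (h2 e he).2⟩⟩

variable (G) in
/-- Some palindromic polynomial with respect to `c` is the image of a polynomial in the edge
variables of exponents at most `k`. -/
def PalForm (k : Sym2 V → ℕ) (c : V →₀ ℕ) : Prop :=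
  ∃ F, HasCost G k F ∧ IsPalindromic c (edgeHom G F)

theorem palForm_zero : PalForm G 0 0 :=
  ⟨1, hasCost_one, by rw [map_one]; exact isPalindromic_one⟩

theorem PalForm.mono {k k' : Sym2 V → ℕ} {c : V →₀ ℕ} (h : PalForm G k c)
    (hk : ∀ e, k e ≤ k' e) : PalForm G k' c := by
  obtain ⟨F, hF, h⟩ := h
  exact ⟨F, hF.mono fun e _ => hk e, h⟩

theorem PalForm.add {k k' : Sym2 V → ℕ} {c c' : V →₀ ℕ} (h : PalForm G k c)
    (h' : PalForm G k' c') : PalForm G (k + k') (c + c') := by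
  obtain ⟨F, hF, h⟩ := h
  obtain ⟨F', hF', h'⟩ := h'
  exact ⟨F * F', hF.mul hF', by rw [map_mul]; exact h.mul h'⟩

theorem PalForm.sum {ι : Type*} (s : Finset ι) {k : ι → Sym2 V → ℕ} {c : ι → V →₀ ℕ}
    (h : ∀ i ∈ s, PalForm G (k i) (c i)) : PalForm G (∑ i ∈ s, k i) (∑ i ∈ s, c i) := by
  classical
  induction s using Finset.induction_on with
  | empty => simpa using palForm_zero
  | insert a s ha ih =>
    rw [sum_insert ha, sum_insert ha]
    exact (h a (mem_insert_self _ _)).add (ih fun i hi => h i (mem_insert_of_mem hi))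

/-- The cost of the edges from `u` to `A`. -/
def starCost (A : Finset V) (u : V) : Sym2 V → ℕ := ∑ p ∈ A, Pi.single s(u, p) 1

/-- The indicator vector of `A`. -/
noncomputable def indVec (A : Finset V) : V →₀ ℕ := ∑ p ∈ A, Finsupp.single p 1

/-- The vertices of `A` are taken two at a time, with (x_u + x_a) - (x_u + x_b) = x_a - x_b. -/
theorem palForm_star_of_even {u : V} (A : Finset V) : (∀ p ∈ A, G.Adj u p) → Even A.card →
    PalForm G (starCost A u) (indVec A) := by
  induction A using Finset.strongInduction with
  | H A ih =>
    intro hA heven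
    by_cases h0 : A = ∅
    · subst h0
      simpa [starCost, indVec] using palForm_zero
    · obtain ⟨a, ha⟩ := nonempty_iff_ne_empty.mpr h0
      have hc := card_erase_add_one ha
      have hne : (A.erase a).Nonempty := by
        rw [← card_pos]
        by_contra h
        have : A.card = 1 := by omega
        rw [this] at heven
        simp at heven
      obtain ⟨b, hb⟩ := hne
      have hc' := card_erase_add_one hb
      have hss : (A.erase a).erase b ⊂ A := (erase_subset _ _).trans_ssubset (erase_ssubset ha)
      have h1 := ih _ hss (fun p hp => hA p (hss.subset hp)) (by
        rw [Nat.even_iff] at heven ⊢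
        omega)
      have h2 : PalForm G (Pi.single s(u, a) 1 + Pi.single s(u, b) 1)
          (Finsupp.single a 1 + Finsupp.single b 1) := by
        refine ⟨edgeVar G u a - edgeVar G u b, (hasCost_edgeVar u a).sub (hasCost_edgeVar u b), ?_⟩
        rw [map_sub, edgeHom_edgeVar (hA a ha), edgeHom_edgeVar (hA b (mem_of_mem_erase hb))]
        have := isPalindromic_X_add_C_mul_X (a := a) (b := b) (s := -1) (Or.inr rfl)
          (Or.inl (ne_of_mem_erase hb).symm)
        convert! this using 1
        rw [C_neg, C_1]
        ring
      have h3 := h2.add h1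
      have e1 : starCost A u = Pi.single s(u, a) 1 + Pi.single s(u, b) 1
          + starCost ((A.erase a).erase b) u := by
        rw [starCost, starCost, ← add_sum_erase _ _ ha, ← add_sum_erase _ _ hb, add_assoc]
      have e2 : indVec A = Finsupp.single a 1 + Finsupp.single b 1
          + indVec ((A.erase a).erase b) := by
        rw [indVec, indVec, ← add_sum_erase _ _ ha, ← add_sum_erase _ _ hb, add_assoc]
      rw [e1, e2]
      exact h3

variable (G) in
/-- Two vertices are adjacent if they have the same single neighbour in `I`. -/
def privateGraph (I : Finset V) : SimpleGraph V where
  Adj u v := u ≠ v ∧ ∃ w, nbrs G I u = {w} ∧ nbrs G I v = {w}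
  symm := ⟨fun _ _ ⟨h, w, h1, h2⟩ => ⟨h.symm, w, h2, h1⟩⟩
  loopless := ⟨fun _ h => h.1 rfl⟩

-- One neighbour p of `u` and q of `v` are joined through the path to give x_p ± x_q; the remaining
-- neighbours are even in number and are paired at `u` and at `v`. The sign of the path is not under
-- control, so p ≠ q is wanted. This fails only when both have the same single neighbour p; then the
-- edge `uv` replaces the path and gives 2 x_p.
open Classical in
theorem PathForm.palForm {I : Finset V} {k : Sym2 V → ℕ} {u v : V} (h : PathForm G k u v)
    (hu : Odd (nbrs G I u).card) (hv : Odd (nbrs G I v).card)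
    (hadj : (privateGraph G I).Adj u v → G.Adj u v) (huv : u ≠ v) :
    PalForm G (k + starCost (nbrs G I u) u + starCost (nbrs G I v) v
        + if (privateGraph G I).Adj u v then Pi.single s(u, v) 1 else 0)
      (indVec (nbrs G I u) + indVec (nbrs G I v)) := by
  have key : ∃ p ∈ nbrs G I u, ∃ q ∈ nbrs G I v,
      PalForm G (k + Pi.single s(u, p) 1 + Pi.single s(v, q) 1
        + if (privateGraph G I).Adj u v then Pi.single s(u, v) 1 else 0)
        (Finsupp.single p 1 + Finsupp.single q 1) := by
    by_cases hpq : ∃ p ∈ nbrs G I u, ∃ q ∈ nbrs G I v, p ≠ q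
    · obtain ⟨p, hp, q, hq, hne⟩ := hpq
      obtain ⟨F, hF, s, hs, h⟩ := h
      refine ⟨p, hp, q, hq, ?_⟩
      have h1 : PalForm G (Pi.single s(u, p) 1 + k + Pi.single s(v, q) 1)
          (Finsupp.single p 1 + Finsupp.single q 1) := by
        refine ⟨edgeVar G u p - F + C s * edgeVar G v q,
          ((hasCost_edgeVar u p).sub hF).add ((hasCost_edgeVar v q).C_mul s), ?_⟩
        have e : edgeHom G (edgeVar G u p - F + C s * edgeVar G v q) = X p + C s * X q := by
          rw [map_add, map_sub, map_mul, h, edgeHom_edgeVar (mem_nbrs.mp hp).2,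
            edgeHom_edgeVar (mem_nbrs.mp hq).2, algHom_C, algebraMap_eq]
          ring
        rw [e]
        exact isPalindromic_X_add_C_mul_X hs (Or.inl hne)
      refine h1.mono fun e => ?_
      simp only [Pi.add_apply]
      omega
    · push Not at hpq
      obtain ⟨p, hp⟩ := card_pos.mp hu.pos
      obtain ⟨q, hq⟩ := card_pos.mp hv.pos
      have hqp := hpq p hp q hq
      subst hqp
      have h1 : nbrs G I u = {p} :=
        eq_singleton_iff_unique_mem.mpr ⟨hp, fun x hx => hpq x hx p hq⟩
      have h2 : nbrs G I v = {p} :=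
        eq_singleton_iff_unique_mem.mpr ⟨hq, fun x hx => (hpq p hp x hx).symm⟩
      have hc : (privateGraph G I).Adj u v := ⟨huv, p, h1, h2⟩
      refine ⟨p, hp, p, hq, ?_⟩
      rw [if_pos hc]
      have h3 : PalForm G (Pi.single s(u, p) 1 + Pi.single s(v, p) 1 + Pi.single s(u, v) 1)
          (Finsupp.single p 1 + Finsupp.single p 1) := by
        refine ⟨edgeVar G u p + edgeVar G v p - edgeVar G u v,
          ((hasCost_edgeVar u p).add (hasCost_edgeVar v p)).sub (hasCost_edgeVar u v), ?_⟩
        have e : edgeHom G (edgeVar G u p + edgeVar G v p - edgeVar G u v) = X p + C 1 * X p := by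
          rw [map_sub, map_add, edgeHom_edgeVar (hadj hc), edgeHom_edgeVar (mem_nbrs.mp hp).2,
            edgeHom_edgeVar (mem_nbrs.mp hq).2, C_1]
          ring
        rw [e]
        exact isPalindromic_X_add_C_mul_X (Or.inl rfl) (Or.inr rfl)
      refine h3.mono fun e => ?_
      simp only [Pi.add_apply]
      omega
  obtain ⟨p, hp, q, hq, h1⟩ := key
  have hrest : ∀ w x, x ∈ nbrs G I w → Odd (nbrs G I w).card →
      PalForm G (starCost ((nbrs G I w).erase x) w) (indVec ((nbrs G I w).erase x)) := by
    intro w x hx hodd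
    refine palForm_star_of_even _ (fun p hp => (mem_nbrs.mp (mem_of_mem_erase hp)).2) ?_
    have := card_erase_add_one hx
    rw [Nat.odd_iff] at hodd
    rw [Nat.even_iff]
    omega
  have h2 := (h1.add (hrest u p hp hu)).add (hrest v q hq hv)
  have e1 : ∀ w x, x ∈ nbrs G I w → starCost (nbrs G I w) w
      = Pi.single s(w, x) 1 + starCost ((nbrs G I w).erase x) w := by
    intro w x hx
    rw [starCost, starCost, ← add_sum_erase _ _ hx]
  have e2 : ∀ w x, x ∈ nbrs G I w → indVec (nbrs G I w)
      = Finsupp.single x 1 + indVec ((nbrs G I w).erase x) := by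
    intro w x hx
    rw [indVec, indVec, ← add_sum_erase _ _ hx]
  rw [e1 u p hp, e1 v q hq, e2 u p hp, e2 v q hq]
  convert! h2 using 1
  · abel
  · abel

-- The pairs are disjoint, so each private edge is charged for at most one of them.
open Classical in
theorem Joined.palForm {I : Finset V} {k : Sym2 V → ℕ} {R : Finset V} (h : Joined G k R)
    (hodd : ∀ u ∈ R, Odd (nbrs G I u).card)
    (hadj : ∀ u ∈ R, ∀ v ∈ R, (privateGraph G I).Adj u v → G.Adj u v) :
    PalForm G (k + ∑ u ∈ R, starCost (nbrs G I u) u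
        + fun e => if e ∈ R.sym2 ∧ e ∈ (privateGraph G I).edgeSet then 1 else 0)
      (∑ u ∈ R, indVec (nbrs G I u)) := by
  induction h with
  | empty =>
    refine palForm_zero.mono fun e => Nat.zero_le _
  | @pair k k' u v R hu hv huv hp hJ ih =>
    have hRs : R ⊆ insert u (insert v R) := (subset_insert _ _).trans (subset_insert _ _)
    have huR : u ∈ insert u (insert v R) := mem_insert_self _ _
    have hvR : v ∈ insert u (insert v R) := mem_insert_of_mem (mem_insert_self _ _)
    have h1 := ih (fun x hx => hodd x (hRs hx)) (fun x hx y hy => hadj x (hRs hx) y (hRs hy))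
    have h2 := (hp.palForm (hodd u huR) (hodd v hvR) (hadj u huR v hvR) huv).add h1
    have hu' : u ∉ insert v R := by simp [huv, hu]
    rw [sum_insert hu', sum_insert hv, sum_insert hu', sum_insert hv,
      ← add_assoc (indVec (nbrs G I u))]
    refine h2.mono fun e => ?_
    have h3 : (if (privateGraph G I).Adj u v then Pi.single s(u, v) 1 else 0 : Sym2 V → ℕ) e
        + (if e ∈ R.sym2 ∧ e ∈ (privateGraph G I).edgeSet then 1 else 0)
        ≤ if e ∈ (insert u (insert v R)).sym2 ∧ e ∈ (privateGraph G I).edgeSet then 1 else 0 := by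
      by_cases he : e = s(u, v)
      · subst he
        have : s(u, v) ∉ R.sym2 := fun h => hu (mk_mem_sym2_iff.mp h).1
        simp only [this, false_and, if_false, add_zero, SimpleGraph.mem_edgeSet, mk_mem_sym2_iff,
          huR, hvR, true_and, and_self]
        split_ifs <;> simp
      · have h0 : (if (privateGraph G I).Adj u v then Pi.single s(u, v) 1 else 0 : Sym2 V → ℕ) e
            = 0 := by
          split_ifs <;> simp [he]
        rw [h0, zero_add]
        by_cases h' : e ∈ R.sym2 ∧ e ∈ (privateGraph G I).edgeSet
        · rw [if_pos h', if_pos ⟨sym2_mono hRs h'.1, h'.2⟩]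
        · rw [if_neg h']
          exact Nat.zero_le _
    simp only [Pi.add_apply] at h3 ⊢
    omega

end Forms

/-! ### A maximum independent set of a component and its demands. -/

section Component

variable {V : Type*} [Fintype V] [LinearOrder V] {G : SimpleGraph V} [DecidableRel G.Adj]

theorem PalForm.deletes {S I : Finset V} (hI : I ⊆ S) (hind : ∀ p ∈ I, ∀ q ∈ I, ¬ G.Adj p q)
    {k : Sym2 V → ℕ} (h : PalForm G k (degVec G S I)) : Deletes G S (S \ I) (k + k) := by
  obtain ⟨F, hF, hP⟩ := h
  obtain ⟨-, ⟨n, hn, hd⟩, -⟩ := id hP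
  obtain ⟨-, -, hs, -⟩ := hP.mul hP
  obtain ⟨c, hc, h⟩ := exists_apolar_mul_graphPoly hI hind (F := edgeHom G F * edgeHom G F)
    (by rw [hd, two_mul]; exact hn.mul hn)
    (fun α hα v hv => by
      by_contra hvI
      have h1 := hs α hα v
      have h2 : degVec G S I v = 0 := by
        rw [degVec, Finsupp.finsetSum_apply]
        refine sum_eq_zero fun p hp => ?_
        have : v ≠ p := fun h => hvI (h ▸ hp)
        simp [this]
      rw [Finsupp.add_apply, h2] at h1
      omega)
    hP.coeff_mul_self_ne_zero
  exact ⟨F * F, hF.mul hF, c, hc, fun F' => by rw [map_mul (edgeHom G), h]⟩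

/-- This serves the case of an odd total degree, where the degree vector is no centre of a
palindromic form: the linear factor accounts for the odd unit at `a`. -/
theorem PalForm.deletes_of_add {S I : Finset V} (hI : I ⊆ S)
    (hind : ∀ p ∈ I, ∀ q ∈ I, ¬ G.Adj p q) {k k' : Sym2 V → ℕ} {c : V →₀ ℕ} (h : PalForm G k c)
    {ψ : MvPolynomial G.edgeSet ℚ} (hψ : HasCost G k' ψ) {a b : V} {s : ℚ}
    (hs : s = 1 ∨ s = -1) (hab : a ≠ b ∨ s = 1) (he : edgeHom G ψ = X a + C s * X b)
    (ha : a ∈ I) (hb : b ∈ I) (hc : Finsupp.single a 1 + c = degVec G S I) :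
    Deletes G S (S \ I) (k' + (k + k)) := by
  obtain ⟨F, hF, hP⟩ := h
  have hX := isPalindromic_X_add_C_mul_X hs hab
  obtain ⟨-, ⟨n, hn, hd⟩, -⟩ := id hP
  obtain ⟨-, ⟨m, hm, hd'⟩, -⟩ := id hX
  obtain ⟨-, -, hsup, -⟩ := hX.mul (hP.mul hP)
  have hcI : ∀ v, v ∉ I → degVec G S I v = 0 := by
    intro v hvI
    rw [degVec, Finsupp.finsetSum_apply]
    refine sum_eq_zero fun p hp => ?_
    have : v ≠ p := fun h => hvI (h ▸ hp)
    simp [this]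
  obtain ⟨c', hc', h⟩ := exists_apolar_mul_graphPoly hI hind
    (F := edgeHom G ψ * (edgeHom G F * edgeHom G F))
    (by
      rw [← hc, he, map_add, hd, two_mul]
      have : m = 1 := by
        rw [map_add, Finsupp.degree_single, Finsupp.degree_single] at hd'
        omega
      rw [this] at hm
      rw [Finsupp.degree_single]
      exact hm.mul (hn.mul hn))
    (fun α hα v hv => by
      rw [he] at hα
      by_contra hvI
      have h1 := hsup α hα v
      have h2 := hcI v hvI
      rw [← hc] at h2
      have hva : v ≠ a := fun h => hvI (h ▸ ha)
      have hvb : v ≠ b := fun h => hvI (h ▸ hb)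
      simp [hva] at h2
      simp [hva, hvb, h2] at h1
      exact hv h1)
    (by
      rw [← hc, he]
      exact hP.coeff_X_add_C_mul_X_mul_self_ne_zero hs hab)
  exact ⟨ψ * (F * F), hψ.mul (hF.mul hF), c', hc', fun F' => by
    rw [map_mul (edgeHom G), map_mul (edgeHom G), h]⟩

theorem Built.root_mem {Γ : SimpleGraph V} {r : V} {S : Finset V} (h : Built Γ r S) : r ∈ S := by
  induction h with
  | root => exact mem_singleton_self r
  | step _ _ _ _ ih => exact mem_insert_of_mem ih

theorem Built.subset {Γ : SimpleGraph V} {r : V} {S A : Finset V} (h : Built Γ r S) (hr : r ∈ A)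
    (hA : ∀ u ∈ A, ∀ v, Γ.Adj u v → v ∈ A) : S ⊆ A := by
  induction h with
  | root => exact singleton_subset_iff.mpr hr
  | step _ _ hq hadj ih => exact insert_subset (hA _ (ih hq) _ hadj.symm) ih

-- The set is the connected component of `r`, obtained as a largest `Built` set.
open Classical in
theorem exists_built_closed (Γ : SimpleGraph V) (r : V) :
    ∃ S, Built Γ r S ∧ ∀ u ∈ S, ∀ v, Γ.Adj u v → v ∈ S := by
  obtain ⟨S, hS, hmax⟩ := exists_max_image (univ.filter (Built Γ r)) card
    ⟨{r}, mem_filter.mpr ⟨mem_univ _, Built.root⟩⟩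
  refine ⟨S, (mem_filter.mp hS).2, fun u hu v huv => ?_⟩
  by_contra hv
  have := hmax (insert v S)
    (mem_filter.mpr ⟨mem_univ _, Built.step (mem_filter.mp hS).2 hv hu huv.symm⟩)
  rw [card_insert_of_notMem hv] at this
  omega

/-- An independent subset of `C` of maximum cardinality dominates `C`, and any two vertices with
the same single neighbour in it are adjacent. -/
theorem exists_maximum_independent (G : SimpleGraph V) [DecidableRel G.Adj] (C : Finset V) :
    ∃ I ⊆ C, (∀ p ∈ I, ∀ q ∈ I, ¬ G.Adj p q) ∧ (∀ u ∈ C \ I, (nbrs G I u).Nonempty) ∧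
      ∀ u ∈ C \ I, ∀ v ∈ C \ I, u ≠ v → ∀ w, nbrs G I u = {w} → nbrs G I v = {w} → G.Adj u v := by
  classical
  obtain ⟨I, hI, hmax⟩ := exists_max_image
    (C.powerset.filter fun I => ∀ p ∈ I, ∀ q ∈ I, ¬ G.Adj p q) card ⟨∅, by simp⟩
  rw [mem_filter, mem_powerset] at hI
  obtain ⟨hIC, hind⟩ := hI
  refine ⟨I, hIC, hind, fun u hu => ?_, fun u hu v hv huv w h1 h2 => ?_⟩
  · rw [mem_sdiff] at hu
    by_contra hne
    rw [not_nonempty_iff_eq_empty, eq_empty_iff_forall_notMem] at hne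
    have hnu : ∀ p ∈ I, ¬ G.Adj u p := fun p hp h => hne p (mem_nbrs.mpr ⟨hp, h⟩)
    have := hmax (insert u I) (by
      rw [mem_filter, mem_powerset]
      refine ⟨insert_subset hu.1 hIC, fun p hp q hq hpq => ?_⟩
      rcases mem_insert.mp hp with h | hp' <;> rcases mem_insert.mp hq with h' | hq'
      · exact hpq.ne (h.trans h'.symm)
      · exact hnu q hq' (h ▸ hpq)
      · exact hnu p hp' (h' ▸ hpq.symm)
      · exact hind p hp' q hq' hpq)
    rw [card_insert_of_notMem hu.2] at this
    omega
  · rw [mem_sdiff] at hu hv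
    by_contra hadj
    have hw : w ∈ I := (mem_nbrs.mp (h1 ▸ mem_singleton_self w : w ∈ nbrs G I u)).1
    have hnu : ∀ p ∈ I.erase w, ¬ G.Adj u p := fun p hp h => by
      have : p ∈ nbrs G I u := mem_nbrs.mpr ⟨mem_of_mem_erase hp, h⟩
      rw [h1, mem_singleton] at this
      exact ne_of_mem_erase hp this
    have hnv : ∀ p ∈ I.erase w, ¬ G.Adj v p := fun p hp h => by
      have : p ∈ nbrs G I v := mem_nbrs.mpr ⟨mem_of_mem_erase hp, h⟩
      rw [h2, mem_singleton] at this
      exact ne_of_mem_erase hp this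
    -- Exchanging `w` for the two nonadjacent vertices `u` and `v` would enlarge `I`.
    have := hmax (insert u (insert v (I.erase w))) (by
      rw [mem_filter, mem_powerset]
      refine ⟨insert_subset hu.1 (insert_subset hv.1 ((erase_subset _ _).trans hIC)),
        fun p hp q hq hpq => ?_⟩
      rcases mem_insert.mp hp with h | hp'
      · rcases mem_insert.mp hq with h' | hq'
        · exact hpq.ne (h.trans h'.symm)
        · rcases mem_insert.mp hq' with h' | hq''
          · exact hadj (h ▸ h' ▸ hpq)
          · exact hnu q hq'' (h ▸ hpq)
      · rcases mem_insert.mp hp' with h | hp''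
        · rcases mem_insert.mp hq with h' | hq'
          · exact hadj (h ▸ h' ▸ hpq.symm)
          · rcases mem_insert.mp hq' with h' | hq''
            · exact hpq.ne (h.trans h'.symm)
            · exact hnv q hq'' (h ▸ hpq)
        · rcases mem_insert.mp hq with h' | hq'
          · exact hnu p hp'' (h' ▸ hpq.symm)
          · rcases mem_insert.mp hq' with h' | hq''
            · exact hnv p hp'' (h' ▸ hpq.symm)
            · exact hind p (mem_of_mem_erase hp'') q (mem_of_mem_erase hq'') hpq)
    have hv' : v ∉ I.erase w := fun h => hv.2 (mem_of_mem_erase h)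
    have hu' : u ∉ insert v (I.erase w) := by
      rw [mem_insert, not_or]
      exact ⟨huv, fun h => hu.2 (mem_of_mem_erase h)⟩
    rw [card_insert_of_notMem hu', card_insert_of_notMem hv', card_erase_of_mem hw] at this
    have := card_pos.mpr ⟨w, hw⟩
    omega

/-- Removing the edges between vertices with the same single neighbour in an independent set does
not disconnect the graph. -/
theorem Built.sdiff_privateGraph {r : V} {C I : Finset V} (hC : Built G r C)
    (hcl : ∀ u ∈ C, ∀ v, G.Adj u v → v ∈ C) (hind : ∀ p ∈ I, ∀ q ∈ I, ¬ G.Adj p q) :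
    Built (G \ privateGraph G I) r C := by
  obtain ⟨B, hB, hBcl⟩ := exists_built_closed (G \ privateGraph G I) r
  have hcross : ∀ u w, nbrs G I u = {w} → (G \ privateGraph G I).Adj u w := by
    intro u w h
    have hw := mem_nbrs.mp (h ▸ mem_singleton_self w : w ∈ nbrs G I u)
    refine ⟨hw.2, ?_⟩
    rintro ⟨-, x, -, hx⟩
    have hx' := mem_nbrs.mp (hx ▸ mem_singleton_self x : x ∈ nbrs G I w)
    exact hind w hw.1 x hx'.1 hx'.2
  have h1 : B ⊆ C := hB.subset hC.root_mem fun u hu v huv => hcl u hu v huv.1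
  have h2 : C ⊆ B := by
    refine hC.subset hB.root_mem fun u hu v huv => ?_
    -- A removed edge `uv` is bypassed through the common neighbour `w`; edges into `I` are never
    -- removed, since a vertex of `I` has no neighbour in `I`.
    by_cases hp : (privateGraph G I).Adj u v
    · obtain ⟨-, w, hw1, hw2⟩ := hp
      exact hBcl w (hBcl u hu w (hcross u w hw1)) v (hcross v w hw2).symm
    · exact hBcl u hu v ⟨huv, hp⟩
  rwa [← h1.antisymm h2]

/-- Both sides count the edges between `I` and the rest of `C`; by closedness and independence these
are all the edges at `I`. -/
theorem degVec_eq_sum_indVec {S C I : Finset V} (hCS : C ⊆ S)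
    (hcl : ∀ u ∈ C, ∀ v, G.Adj u v → v ∈ C) (hIC : I ⊆ C) (hind : ∀ p ∈ I, ∀ q ∈ I, ¬ G.Adj p q) :
    ∑ u ∈ C \ I, indVec (nbrs G I u) = degVec G S I := by
  have hsingle : ∀ (A : Finset V) (p : V), indVec A p = if p ∈ A then 1 else 0 := by
    intro A p
    rw [indVec, Finsupp.finsetSum_apply]
    simp [Finsupp.single_apply]
  ext p
  rw [Finsupp.finsetSum_apply]
  simp only [hsingle]
  by_cases hp : p ∈ I
  · rw [degVec_apply hp, ← card_filter]
    congr 1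
    ext u
    simp only [mem_filter, mem_sdiff, mem_nbrs]
    constructor
    · rintro ⟨⟨h1, -⟩, -, h2⟩
      exact ⟨hCS h1, h2.symm⟩
    · rintro ⟨-, h⟩
      exact ⟨⟨hcl p (hIC hp) u h, fun hu => hind p hp u hu h⟩, hp, h.symm⟩
  · rw [degVec, Finsupp.finsetSum_apply, sum_eq_zero, sum_eq_zero]
    · intro q hq
      have : p ≠ q := fun h => hp (h ▸ hq)
      simp [this]
    · intro u _
      rw [if_neg]
      exact fun h => hp (mem_nbrs.mp h).1

open Classical in
/-- The demands of a set `Y` of vertices outside `I` are met by a palindromic form if an even number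
of them is odd. -/
theorem exists_palForm_sum {r : V} {C I Y : Finset V}
    (hC : Built (G \ privateGraph G I) r C) (hY : Y ⊆ C)
    (hadj : ∀ u ∈ Y, ∀ v ∈ Y, (privateGraph G I).Adj u v → G.Adj u v)
    (heven : Even (Y.filter fun u => Odd (nbrs G I u).card).card) :
    ∃ k : Sym2 V → ℕ, (∀ e, k e ≤ 1) ∧
      (∀ e, k e ≠ 0 → e ∈ C.sym2 ∧ e ∉ (privateGraph G I).edgeSet) ∧
      PalForm G (k + (∑ u ∈ Y, starCost (nbrs G I u) u)
        + fun e => if e ∈ Y.sym2 ∧ e ∈ (privateGraph G I).edgeSet then 1 else 0)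
        (∑ u ∈ Y, indVec (nbrs G I u)) := by
  obtain ⟨k, hJ, h1, h2⟩ := hC.exists_joined sdiff_le
    (Y.filter fun u => Odd (nbrs G I u).card) ((filter_subset _ _).trans hY) heven
  refine ⟨k, h1, fun e he => ⟨(h2 e he).2, ?_⟩, ?_⟩
  · have := (h2 e he).1
    rw [SimpleGraph.edgeSet_sdiff] at this
    exact this.2
  · have h3 := hJ.palForm (I := I) (fun u hu => (mem_filter.mp hu).2)
      (fun u hu v hv => hadj u (filter_subset _ _ hu) v (filter_subset _ _ hv))
    have h4 := PalForm.sum (G := G) (Y.filter fun u => ¬ Odd (nbrs G I u).card)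
      (k := fun u => starCost (nbrs G I u) u) (c := fun u => indVec (nbrs G I u))
      (fun u hu => palForm_star_of_even _ (fun p hp => (mem_nbrs.mp hp).2)
        (Nat.not_odd_iff_even.mp (mem_filter.mp hu).2))
    have h5 := h3.add h4
    rw [sum_filter_add_sum_filter_not] at h5
    refine h5.mono fun e => ?_
    rw [← sum_filter_add_sum_filter_not Y (fun u => Odd (nbrs G I u).card)
      (fun u => starCost (nbrs G I u) u)]
    have h6 : (if e ∈ (Y.filter fun u => Odd (nbrs G I u).card).sym2
          ∧ e ∈ (privateGraph G I).edgeSet then 1 else 0)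
        ≤ if e ∈ Y.sym2 ∧ e ∈ (privateGraph G I).edgeSet then 1 else 0 := by
      by_cases h : e ∈ (Y.filter fun u => Odd (nbrs G I u).card).sym2
          ∧ e ∈ (privateGraph G I).edgeSet
      · rw [if_pos h, if_pos ⟨sym2_mono (filter_subset _ _) h.1, h.2⟩]
      · rw [if_neg h]
        exact Nat.zero_le _
    simp only [Pi.add_apply]
    omega

theorem single_add_single_apply_le {α : Type*} [DecidableEq α] {x y : α} (h : x ≠ y) (e : α) :
    (Pi.single x 1 + Pi.single y 1 : α → ℕ) e ≤ 1 := by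
  by_cases h1 : e = x
  · subst h1
    simp [h]
  · by_cases h2 : e = y
    · subst h2
      simp [Ne.symm h]
    · simp [h1, h2]

theorem eq_of_single_add_single_ne_zero {α : Type*} [DecidableEq α] {x y e : α}
    (h : (Pi.single x 1 + Pi.single y 1 : α → ℕ) e ≠ 0) : e = x ∨ e = y := by
  by_contra hcon
  rw [not_or] at hcon
  exact h (by simp [hcon.1, hcon.2])

/-- In a nice graph the demand of `u` at one of its neighbours in `I` can be met by a form that is
cheap apart from the edges at one vertex `v`. -/
theorem exists_single_form (hG : IsNice G) {C I : Finset V}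
    (hcl : ∀ u ∈ C, ∀ v, G.Adj u v → v ∈ C) (hIC : I ⊆ C) (hind : ∀ p ∈ I, ∀ q ∈ I, ¬ G.Adj p q)
    (hdom : ∀ u ∈ C \ I, (nbrs G I u).Nonempty)
    (hpriv : ∀ u ∈ C \ I, ∀ v ∈ C \ I, u ≠ v → ∀ w, nbrs G I u = {w} → nbrs G I v = {w} → G.Adj u v)
    {u : V} (hu : u ∈ C \ I) :
    ∃ v ∈ C \ I, ∃ p ∈ nbrs G I u, ∃ b ∈ I, ∃ s : ℚ, (s = 1 ∨ s = -1) ∧ (p ≠ b ∨ s = 1) ∧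
      ∃ (k : Sym2 V → ℕ) (ψ : MvPolynomial G.edgeSet ℚ), HasCost G k ψ ∧
        edgeHom G ψ = X p + MvPolynomial.C s * X b ∧ (∀ e, k e ≤ 1) ∧ (∀ e, k e ≠ 0 → e ∈ C.sym2) ∧
        ∀ e, k e ≠ 0 → v ∈ e ∨ e = s(u, p) ∨ e ∈ (C \ I).sym2 := by
  have local_form : ∀ v ∈ C \ I, ∀ p ∈ nbrs G I v, ∀ b ∈ nbrs G I v, p ≠ b → p ∈ nbrs G I u →
      ∃ v ∈ C \ I, ∃ p ∈ nbrs G I u, ∃ b ∈ I, ∃ s : ℚ, (s = 1 ∨ s = -1) ∧ (p ≠ b ∨ s = 1) ∧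
      ∃ (k : Sym2 V → ℕ) (ψ : MvPolynomial G.edgeSet ℚ), HasCost G k ψ ∧
        edgeHom G ψ = X p + MvPolynomial.C s * X b ∧ (∀ e, k e ≤ 1) ∧ (∀ e, k e ≠ 0 → e ∈ C.sym2) ∧
        ∀ e, k e ≠ 0 → v ∈ e ∨ e = s(u, p) ∨ e ∈ (C \ I).sym2 := by
    intro v hv p hp b hb hpb hpu
    have hvC := (mem_sdiff.mp hv).1
    refine ⟨v, hv, p, hpu, b, (mem_nbrs.mp hb).1, -1, Or.inr rfl, Or.inl hpb, _,
      edgeVar G v p - edgeVar G v b, (hasCost_edgeVar v p).sub (hasCost_edgeVar v b), ?_,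
      single_add_single_apply_le fun h => hpb (Sym2.congr_right.mp h), fun e he => ?_,
      fun e he => Or.inl ?_⟩
    · rw [map_sub, edgeHom_edgeVar (mem_nbrs.mp hp).2, edgeHom_edgeVar (mem_nbrs.mp hb).2, C_neg, C_1]
      ring
    · rcases eq_of_single_add_single_ne_zero he with rfl | rfl
      · exact mk_mem_sym2_iff.mpr ⟨hvC, hIC (mem_nbrs.mp hp).1⟩
      · exact mk_mem_sym2_iff.mpr ⟨hvC, hIC (mem_nbrs.mp hb).1⟩
    · rcases eq_of_single_add_single_ne_zero he with rfl | rfl <;> simp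
  -- With two neighbours of `u` in `I`, their difference at `u` itself serves.
  by_cases h2 : 1 < (nbrs G I u).card
  · obtain ⟨p, hp, b, hb, hpb⟩ := one_lt_card.mp h2
    exact local_form u hu p hp b hb hpb hp
  · have h1 : (nbrs G I u).card = 1 := by
      have := card_pos.mpr (hdom u hu)
      omega
    obtain ⟨w, hw⟩ := card_eq_one.mp h1
    have hwu := hw ▸ mem_singleton_self w
    obtain ⟨hwI, huw⟩ := mem_nbrs.mp hwu
    obtain ⟨huC, huI⟩ := mem_sdiff.mp hu
    -- The path w, u, v, b has three edges, so its alternating sum is x_w + x_b, which is nonzero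
    -- even if w = b.
    by_cases hex : ∃ v ∈ C \ I, G.Adj u v
    · obtain ⟨v, hv, huv⟩ := hex
      obtain ⟨b, hb⟩ := hdom v hv
      obtain ⟨hbI, hvb⟩ := mem_nbrs.mp hb
      obtain ⟨hvC, hvI⟩ := mem_sdiff.mp hv
      have n1 : s(u, w) ≠ s(u, v) := fun h => hvI (Sym2.congr_right.mp h ▸ hwI)
      have hub : u ≠ b := fun h => huI (h ▸ hbI)
      have n2 : s(u, v) ≠ s(v, b) := by
        rw [Sym2.eq_swap]
        exact fun h => hub (Sym2.congr_right.mp h)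
      have n3 : s(u, w) ≠ s(v, b) := by
        intro h
        rcases Sym2.eq_iff.mp h with ⟨h, -⟩ | ⟨h, -⟩
        · exact huv.ne h
        · exact hub h
      have hcase : ∀ e, (Pi.single s(u, w) 1 + Pi.single s(u, v) 1 + Pi.single s(v, b) 1
          : Sym2 V → ℕ) e ≠ 0 → e = s(u, w) ∨ e = s(u, v) ∨ e = s(v, b) := by
        intro e he
        by_contra hcon
        simp only [not_or] at hcon
        exact he (by simp [hcon.1, hcon.2.1, hcon.2.2])
      refine ⟨v, hv, w, hwu, b, hbI, 1, Or.inl rfl, Or.inr rfl, _,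
        edgeVar G u w - edgeVar G u v + edgeVar G v b,
        ((hasCost_edgeVar u w).sub (hasCost_edgeVar u v)).add (hasCost_edgeVar v b), ?_,
        fun e => ?_, fun e he => ?_, fun e he => ?_⟩
      · rw [map_add, map_sub, edgeHom_edgeVar huw, edgeHom_edgeVar huv, edgeHom_edgeVar hvb, C_1]
        ring
      · by_cases h3 : e = s(v, b)
        · subst h3
          simp [n2.symm, n3.symm]
        · rw [Pi.add_apply, Pi.single_eq_of_ne h3, add_zero]
          exact single_add_single_apply_le n1 e
      · rcases hcase e he with rfl | rfl | rfl
        · exact mk_mem_sym2_iff.mpr ⟨huC, hIC hwI⟩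
        · exact mk_mem_sym2_iff.mpr ⟨huC, hvC⟩
        · exact mk_mem_sym2_iff.mpr ⟨hvC, hIC hbI⟩
      · rcases hcase e he with rfl | rfl | rfl
        · exact Or.inr (Or.inl rfl)
        · exact Or.inl (by simp)
        · exact Or.inl (by simp)
    -- Here `u` is a leaf, and only niceness gives a further edge, which must start at `w`.
    · have hne : ¬ IsIsolatedEdge G s(u, w) := hG _
      have : ∃ f ∈ G.edgeSet, f ≠ s(u, w) ∧ ∃ x ∈ s(u, w), x ∈ f := by
        by_contra hcon
        apply hne
        refine ⟨huw, fun f hf hfe x hx hxf => hcon ⟨f, hf, hfe, x, hx, hxf⟩⟩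
      obtain ⟨f, hf, hfe, x, hx, hxf⟩ := this
      obtain ⟨y, rfl⟩ := hxf
      have hxy : G.Adj x y := hf
      rcases Sym2.mem_iff.mp hx with rfl | rfl
      · exfalso
        have hyC := hcl x huC y hxy
        have hyI : y ∈ I := by
          by_contra hyI
          exact hex ⟨y, mem_sdiff.mpr ⟨hyC, hyI⟩, hxy⟩
        have : y ∈ nbrs G I x := mem_nbrs.mpr ⟨hyI, hxy⟩
        rw [hw, mem_singleton] at this
        exact hfe (by rw [this])
      · have hyu : y ≠ u := fun h => hfe (by rw [h, Sym2.eq_swap])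
        have hyC : y ∈ C \ I :=
          mem_sdiff.mpr ⟨hcl x (hIC hwI) y hxy, fun h => hind x hwI y h hxy⟩
        have hxy' : x ∈ nbrs G I y := mem_nbrs.mpr ⟨hwI, hxy.symm⟩
        -- Were `x` the only neighbour of `y` in `I`, `hpriv` would make `u` and `y` adjacent,
        -- against `hex`.
        have : ∃ b ∈ nbrs G I y, x ≠ b := by
          by_contra hcon
          push Not at hcon
          have hy : nbrs G I y = {x} :=
            eq_singleton_iff_unique_mem.mpr ⟨hxy', fun b hb => (hcon b hb).symm⟩
          exact hex ⟨y, hyC, hpriv u hu y hyC hyu.symm x hw hy⟩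
        obtain ⟨b, hb, hxb⟩ := this
        exact local_form y hyC x hxy' b hb hxb hwu

end Component

/-! ### Counting the uses of each edge, and assembling the components. -/

section Global

variable {V : Type*} [Fintype V] [LinearOrder V] {G : SimpleGraph V} [DecidableRel G.Adj]

theorem sum_starCost_apply (Y : Finset V) (A : V → Finset V) (e : Sym2 V) :
    (∑ u ∈ Y, starCost (A u) u) e
      = ((Y.sigma fun u => A u).filter fun x : (_ : V) × V => e = s(x.1, x.2)).card := by
  rw [card_filter, sum_sigma, Finset.sum_apply]
  refine sum_congr rfl fun u _ => ?_
  rw [starCost, Finset.sum_apply]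
  refine sum_congr rfl fun p _ => ?_
  rw [Pi.single_apply]

/-- An edge between `Y` and `I` belongs to the star of its end in `Y` only. -/
theorem sum_starCost_le_one {Y I : Finset V} {A : V → Finset V} (hY : ∀ u ∈ Y, u ∉ I)
    (hA : ∀ u ∈ Y, A u ⊆ I) (e : Sym2 V) : (∑ u ∈ Y, starCost (A u) u) e ≤ 1 := by
  rw [sum_starCost_apply, card_le_one]
  rintro ⟨u, p⟩ h ⟨v, q⟩ h'
  rw [mem_filter, mem_sigma] at h h'
  rcases Sym2.eq_iff.mp (h.2.symm.trans h'.2) with ⟨h1, h2⟩ | ⟨h1, h2⟩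
  · dsimp only at h1 h2
    rw [h1, h2]
  · dsimp only at h1 h2
    exact absurd (hA v h'.1.1 h'.1.2) (h1 ▸ hY u h.1.1)

theorem exists_of_sum_starCost_ne_zero {Y : Finset V} {A : V → Finset V} {e : Sym2 V}
    (h : (∑ u ∈ Y, starCost (A u) u) e ≠ 0) : ∃ u ∈ Y, ∃ p ∈ A u, e = s(u, p) := by
  rw [sum_starCost_apply, card_ne_zero] at h
  obtain ⟨⟨u, p⟩, hx⟩ := h
  rw [mem_filter, mem_sigma] at hx
  exact ⟨u, hx.1.1, p, hx.1.2, hx.2⟩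

-- An edge between `C \ I` and `I` is charged at most 2 for paths, 2 for stars, 1 for `k'` and 1 as
-- a token. These six become five by `hk'3`: where `k'` is charged, either the edge is at `v`, which
-- needs no token, or it lies in no star. An edge inside `C \ I` is charged 2 for paths or as a
-- private edge, never both, 2 in the elimination, and 1 for `k'`.
open Classical in
theorem deletes_component_of_deletes {S C I : Finset V} (hCS : C ⊆ S)
    (hcl : ∀ u ∈ C, ∀ v, G.Adj u v → v ∈ C) (hIC : I ⊆ C)
    (hdom : ∀ u ∈ C \ I, (nbrs G I u).Nonempty) {v : V} (hv : v ∈ C \ I) {k k' : Sym2 V → ℕ}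
    {A : V → Finset V} (hA : ∀ u ∈ C \ I, A u ⊆ nbrs G I u)
    (hk : ∀ e, k e ≤ 1) (hk2 : ∀ e, k e ≠ 0 → e ∈ C.sym2 ∧ e ∉ (privateGraph G I).edgeSet)
    (hk' : ∀ e, k' e ≤ 1) (hk'2 : ∀ e, k' e ≠ 0 → e ∈ C.sym2)
    (hk'3 : ∀ e, k' e ≠ 0 → v ∈ e ∨ (∀ u ∈ C \ I, ∀ p ∈ A u, e ≠ s(u, p)) ∨ e ∈ (C \ I).sym2)
    (h : Deletes G S (S \ I) (k' +
      ((k + (∑ u ∈ C \ I, starCost (A u) u)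
        + fun e => if e ∈ (C \ I).sym2 ∧ e ∈ (privateGraph G I).edgeSet then 1 else 0) +
      (k + (∑ u ∈ C \ I, starCost (A u) u)
        + fun e => if e ∈ (C \ I).sym2 ∧ e ∈ (privateGraph G I).edgeSet then 1 else 0)))) :
    Deletes G S (S \ C) fun e => if e ∈ C.sym2 then 5 else 0 := by
  have hdom' : ∀ u, ∃ p, u ∈ C \ I → p ∈ nbrs G I u := fun u => by
    by_cases hu : u ∈ C \ I
    · obtain ⟨p, hp⟩ := hdom u hu
      exact ⟨p, fun _ => hp⟩
    · exact ⟨u, fun h => absurd h hu⟩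
  choose t ht using hdom'
  have hYI : ∀ u ∈ C \ I, u ∉ I := fun u hu => (mem_sdiff.mp hu).2
  have hnI : ∀ u, nbrs G I u ⊆ I := fun u p hp => (mem_nbrs.mp hp).1
  have htok := deletes_sdiff_of_tokens (G := G) (C \ I).card (S \ I) (C \ I) t v rfl
    (sdiff_subset_sdiff hCS subset_rfl) hv
    (fun u hu w hw huw => mem_sdiff.mpr
      ⟨hcl u (mem_sdiff.mp hu).1 w huw, (mem_sdiff.mp hw).2⟩)
    (fun u hu _ => ⟨(mem_nbrs.mp (ht u hu)).2, fun hm => (mem_sdiff.mp hm).2 (hnI u (ht u hu))⟩)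
  have hset : (S \ I) \ (C \ I) = S \ C := by
    ext x
    simp only [mem_sdiff]
    constructor
    · rintro ⟨⟨h1, h2⟩, h3⟩
      exact ⟨h1, fun h => h3 ⟨h, h2⟩⟩
    · rintro ⟨h1, h2⟩
      exact ⟨⟨h1, fun h => h2 (hIC h)⟩, fun h => h2 h.1⟩
  have htok_eq : (∑ u ∈ (C \ I).erase v, Pi.single s(u, t u) 1 : Sym2 V → ℕ)
      = ∑ u ∈ (C \ I).erase v, starCost {t u} u :=
    sum_congr rfl fun u _ => by rw [starCost, sum_singleton]
  rw [hset, htok_eq] at htok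
  refine (h.trans htok).mono fun e _ => ?_
  have o1 := sum_starCost_le_one hYI (fun u hu => (hA u hu).trans (hnI u)) e
  have o2 := sum_starCost_le_one (Y := (C \ I).erase v) (I := I) (A := fun u => {t u})
    (fun u hu => hYI u (mem_of_mem_erase hu))
    (fun u hu => singleton_subset_iff.mpr (hnI u (ht u (mem_of_mem_erase hu)))) e
  have o3 := hk e
  have o4 := hk' e
  simp only [Pi.add_apply]
  by_cases hX : ∃ u ∈ C \ I, ∃ p ∈ nbrs G I u, e = s(u, p)
  · obtain ⟨u, hu, p, hp, rfl⟩ := hX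
    have hpI := hnI u hp
    have huC := (mem_sdiff.mp hu).1
    have c1 : s(u, p) ∉ (C \ I).sym2 := fun hm => hYI p (mk_mem_sym2_iff.mp hm).2 hpI
    have c2 : s(u, p) ∈ C.sym2 := mk_mem_sym2_iff.mpr ⟨huC, hIC hpI⟩
    rw [if_neg fun hc => c1 hc.1, if_neg c1, if_pos c2]
    by_cases hk0 : k' s(u, p) = 0
    · omega
    · rcases hk'3 _ hk0 with h1 | h1 | h1
      · have : (∑ u ∈ (C \ I).erase v, starCost {t u} u) s(u, p) = 0 := by
          by_contra hne
          obtain ⟨x, hx, y, hy, hxy⟩ := exists_of_sum_starCost_ne_zero hne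
          rw [hxy, Sym2.mem_iff] at h1
          rcases h1 with h1 | h1
          · exact ne_of_mem_erase hx h1.symm
          · rw [mem_singleton] at hy
            exact hYI v hv (h1 ▸ hy ▸ hnI x (ht x (mem_of_mem_erase hx)))
        omega
      · have : (∑ u ∈ C \ I, starCost (A u) u) s(u, p) = 0 := by
          by_contra hne
          obtain ⟨x, hx, y, hy, hxy⟩ := exists_of_sum_starCost_ne_zero hne
          exact h1 x hx y hy hxy
        omega
      · exact absurd h1 c1
  · have z1 : (∑ u ∈ C \ I, starCost (A u) u) e = 0 := by
      by_contra hne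
      obtain ⟨x, hx, y, hy, hxy⟩ := exists_of_sum_starCost_ne_zero hne
      exact hX ⟨x, hx, y, hA x hx hy, hxy⟩
    have z2 : (∑ u ∈ (C \ I).erase v, starCost {t u} u) e = 0 := by
      by_contra hne
      obtain ⟨x, hx, y, hy, hxy⟩ := exists_of_sum_starCost_ne_zero hne
      rw [mem_singleton] at hy
      exact hX ⟨x, mem_of_mem_erase hx, y, hy ▸ ht x (mem_of_mem_erase hx), hxy⟩
    rw [z1, z2]
    by_cases hc : e ∈ C.sym2
    · rw [if_pos hc]
      by_cases hp : e ∈ (privateGraph G I).edgeSet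
      · have : k e = 0 := by
          by_contra hne
          exact (hk2 e hne).2 hp
        rw [this]
        split_ifs <;> omega
      · rw [if_neg fun h => hp h.2]
        split_ifs <;> omega
    · have hc' : e ∉ (C \ I).sym2 := fun h => hc (sym2_mono sdiff_subset h)
      have zk : k e = 0 := by
        by_contra hne
        exact hc (hk2 e hne).1
      have zk' : k' e = 0 := by
        by_contra hne
        exact hc (hk'2 e hne)
      rw [if_neg hc, if_neg fun h => hc' h.1, if_neg hc', zk, zk']

/-- The parity of the number of edges leaving `I`, which is that of the number of odd vertices
outside `I`, decides whether Φ² alone serves or the extra linear factor is needed. -/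
theorem deletes_component (hG : IsNice G) {S C : Finset V} {r : V} (hCS : C ⊆ S)
    (hC : Built G r C) (hcl : ∀ u ∈ C, ∀ v, G.Adj u v → v ∈ C) :
    Deletes G S (S \ C) fun e => if e ∈ C.sym2 then 5 else 0 := by
  classical
  obtain ⟨I, hIC, hind, hdom, hpriv⟩ := exists_maximum_independent G C
  have hB := hC.sdiff_privateGraph hcl hind
  have hdeg := degVec_eq_sum_indVec hCS hcl hIC hind
  have hadj : ∀ u ∈ C \ I, ∀ v ∈ C \ I, (privateGraph G I).Adj u v → G.Adj u v := by
    rintro u hu v hv ⟨huv, w, h1, h2⟩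
    exact hpriv u hu v hv huv w h1 h2
  by_cases hev : Even ((C \ I).filter fun u => Odd (nbrs G I u).card).card
  · rcases (C \ I).eq_empty_or_nonempty with h0 | ⟨v, hv⟩
    · have hI : I = C := hIC.antisymm (sdiff_eq_empty_iff_subset.mp h0)
      rw [h0, sum_empty] at hdeg
      have h1 := palForm_zero (G := G)
      rw [hdeg] at h1
      rw [← hI]
      exact (h1.deletes (hIC.trans hCS) hind).mono fun e _ => by simp
    · obtain ⟨k, hk1, hk2, hP⟩ := exists_palForm_sum hB sdiff_subset hadj hev
      rw [hdeg] at hP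
      have hD := hP.deletes (hIC.trans hCS) hind
      exact deletes_component_of_deletes hCS hcl hIC hdom hv (k' := 0)
        (fun u _ => subset_rfl) hk1 hk2 (fun e => Nat.zero_le _) (fun e h => absurd rfl h)
        (fun e h => absurd rfl h) (by rwa [zero_add])
  · obtain ⟨u, hu⟩ : ((C \ I).filter fun u => Odd (nbrs G I u).card).Nonempty := by
      by_contra h
      rw [not_nonempty_iff_eq_empty] at h
      exact hev (by simp [h])
    obtain ⟨huY, hodd⟩ := mem_filter.mp hu
    obtain ⟨v, hv, p, hp, b, hb, s, hs, hpb, k', ψ, hψ, hψ', hk'1, hk'2, hk'3⟩ :=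
      exists_single_form hG hcl hIC hind hdom hpriv huY
    have hev' : Even (((C \ I).erase u).filter fun u => Odd (nbrs G I u).card).card := by
      rw [filter_erase, card_erase_of_mem hu]
      have h1 := card_pos.mpr ⟨u, hu⟩
      rw [Nat.not_even_iff_odd] at hev
      exact Nat.Odd.sub_odd hev odd_one
    obtain ⟨k, hk1, hk2, hP⟩ := exists_palForm_sum hB ((erase_subset u _).trans sdiff_subset)
      (fun x hx y hy => hadj x (mem_of_mem_erase hx) y (mem_of_mem_erase hy)) hev'
    have hQ : PalForm G (starCost ((nbrs G I u).erase p) u) (indVec ((nbrs G I u).erase p)) :=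
      palForm_star_of_even _ (fun q hq => (mem_nbrs.mp (mem_of_mem_erase hq)).2) (by
        rw [card_erase_of_mem hp]
        exact Nat.Odd.sub_odd hodd odd_one)
    -- The linear form meets the demand of `u` at `p`, so `p` leaves the star of `u`, whose
    -- remainder is even; this frees the edge `up` for the linear form.
    let A : V → Finset V := Function.update (nbrs G I) u ((nbrs G I u).erase p)
    have hAu : A u = (nbrs G I u).erase p := Function.update_self ..
    have hAx : ∀ x, x ≠ u → A x = nbrs G I x := fun x hx => Function.update_of_ne hx ..
    have hAsub : ∀ x ∈ C \ I, A x ⊆ nbrs G I x := fun x _ => by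
      by_cases hx : x = u
      · subst hx
        rw [hAu]
        exact erase_subset _ _
      · rw [hAx x hx]
    have hPQ : PalForm G (k + (∑ u ∈ C \ I, starCost (A u) u)
        + fun e => if e ∈ (C \ I).sym2 ∧ e ∈ (privateGraph G I).edgeSet then 1 else 0)
        ((∑ x ∈ (C \ I).erase u, indVec (nbrs G I x)) + indVec ((nbrs G I u).erase p)) := by
      refine (hP.add hQ).mono fun e => ?_
      have h7 : ∑ x ∈ (C \ I).erase u, starCost (A x) x
          = ∑ x ∈ (C \ I).erase u, starCost (nbrs G I x) x :=
        sum_congr rfl fun x hx => by rw [hAx x (ne_of_mem_erase hx)]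
      rw [← sum_erase_add _ _ huY, hAu, h7]
      have h6 : (if e ∈ ((C \ I).erase u).sym2 ∧ e ∈ (privateGraph G I).edgeSet then 1 else 0)
          ≤ if e ∈ (C \ I).sym2 ∧ e ∈ (privateGraph G I).edgeSet then 1 else 0 := by
        by_cases h : e ∈ ((C \ I).erase u).sym2 ∧ e ∈ (privateGraph G I).edgeSet
        · rw [if_pos h, if_pos ⟨sym2_mono (erase_subset _ _) h.1, h.2⟩]
        · rw [if_neg h]
          exact Nat.zero_le _
      simp only [Pi.add_apply]
      omega
    have hD := hPQ.deletes_of_add (hIC.trans hCS) hind hψ hs hpb hψ' (mem_nbrs.mp hp).1 hb (by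
      rw [← hdeg, ← sum_erase_add _ _ huY, indVec, indVec, ← add_sum_erase _ _ hp]
      abel)
    refine deletes_component_of_deletes hCS hcl hIC hdom hv hAsub hk1 hk2 hk'1 hk'2
      (fun e he => ?_) hD
    rcases hk'3 e he with h | h | h
    · exact Or.inl h
    · refine Or.inr (Or.inl ?_)
      rintro x hx y hy rfl
      have hyI := (mem_nbrs.mp (hAsub x hx hy)).1
      rcases Sym2.eq_iff.mp h with ⟨rfl, rfl⟩ | ⟨-, rfl⟩
      · rw [hAu] at hy
        exact notMem_erase _ _ hy
      · exact (mem_sdiff.mp huY).2 hyI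
    · exact Or.inr (Or.inr h)

theorem deletes_all (hG : IsNice G) (S : Finset V) (hcl : ∀ u ∈ S, ∀ v, G.Adj u v → v ∈ S) :
    Deletes G S ∅ fun e => if e ∈ S.sym2 then 5 else 0 := by
  induction S using Finset.strongInduction with
  | H S ih =>
    rcases S.eq_empty_or_nonempty with rfl | ⟨r, hr⟩
    · exact (deletes_refl ∅).mono fun e _ => Nat.zero_le _
    · obtain ⟨C, hC, hCcl⟩ := exists_built_closed G r
      have hCS : C ⊆ S := hC.subset hr hcl
      have h1 := deletes_component hG hCS hC hCcl
      have h2 := ih (S \ C) (sdiff_ssubset hCS ⟨r, hC.root_mem⟩) fun u hu v huv => by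
        rw [mem_sdiff] at hu ⊢
        exact ⟨hcl u hu.1 v huv, fun hv => hu.2 (hCcl v hv u huv.symm)⟩
      refine (h1.trans h2).mono fun e _ => ?_
      have m1 : e ∈ C.sym2 → e ∈ S.sym2 := fun h => sym2_mono hCS h
      have m2 : e ∈ (S \ C).sym2 → e ∈ S.sym2 := fun h => sym2_mono sdiff_subset h
      have m3 : e ∈ C.sym2 → e ∉ (S \ C).sym2 := by
        induction e with
        | _ x y =>
          intro h h'
          exact (mem_sdiff.mp (mk_mem_sym2_iff.mp h').1).2 (mk_mem_sym2_iff.mp h).1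
      simp only [Pi.add_apply]
      by_cases c1 : e ∈ C.sym2
      · rw [if_pos c1, if_neg (m3 c1), if_pos (m1 c1)]
      · rw [if_neg c1, zero_add]
        by_cases c2 : e ∈ (S \ C).sym2
        · rw [if_pos c2, if_pos (m2 c2)]
        · rw [if_neg c2]
          exact Nat.zero_le _

end Global

/-! ### Back to coefficients of the total weight polynomial. -/

section Final

variable {V : Type*} [Fintype V] [LinearOrder V] (G : SimpleGraph V) [DecidableRel G.Adj]

/-- The coefficient of the variable `z` in the linear form of the vertex `v`. -/
def incidence (v : V) (z : V ⊕ G.edgeSet) : ℚ :=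
  Sum.elim (fun w => if w = v then 1 else 0) (fun e => if v ∈ e.1 then 1 else 0) z

theorem map_sum_incidence (v : V) :
    MvPolynomial.map (algebraMap ℚ ℂ) (∑ z, C (incidence G v z) * X z) = vertexSum G v := by
  rw [map_sum, Fintype.sum_sum_type, vertexSum, add_comm, sum_filter]
  congr 1
  · refine sum_congr rfl fun e _ => ?_
    rw [map_mul, map_C, map_X, incidence, Sum.elim_inr]
    split_ifs <;> simp
  · rw [sum_eq_single v]
    · simp [incidence]
    · intro w _ hw
      simp [incidence, hw]
    · simp

theorem map_aeval_graphPoly :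
    MvPolynomial.map (algebraMap ℚ ℂ)
      (aeval (fun v => ∑ z, C (incidence G v z) * X z) (graphPoly G univ)) = totalPoly G := by
  have h1 : graphPoly G univ = ∏ e : G.edgeSet, (X e.1.inf - X e.1.sup) := by
    rw [graphPoly, sym2_univ, inter_univ]
    exact (prod_subtype _ (fun e => SimpleGraph.mem_edgeFinset) _)
  rw [h1, map_prod, map_prod, totalPoly]
  refine prod_congr rfl fun e _ => ?_
  rw [map_sub, map_sub, aeval_X, aeval_X, map_sum_incidence, map_sum_incidence]

theorem isHomogeneous_totalPoly : (totalPoly G).IsHomogeneous G.edgeFinset.card := by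
  have h1 : ∀ v, (vertexSum G v).IsHomogeneous 1 := fun v =>
    (IsHomogeneous.sum _ _ _ fun e _ => isHomogeneous_X _ _).add (isHomogeneous_X _ _)
  have h2 := IsHomogeneous.prod univ (fun e : G.edgeSet => vertexSum G e.1.inf - vertexSum G e.1.sup)
    (fun _ => 1) fun e _ => (h1 _).sub (h1 _)
  rw [sum_const, card_univ, smul_eq_mul, mul_one, ← SimpleGraph.edgeFinset_card] at h2
  exact h2

variable {G}

theorem Deletes.exists_coeff_totalPoly_ne_zero {k : Sym2 V → ℕ} (h : Deletes G univ ∅ k) :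
    ∃ K : (V ⊕ G.edgeSet) →₀ ℕ, (∀ v, K (Sum.inl v) = 0) ∧
      (∀ e : G.edgeSet, K (Sum.inr e) ≤ k e) ∧ coeff K (totalPoly G) ≠ 0 := by
  obtain ⟨F, hF, c, hc, h⟩ := h
  have h1 := h 1
  have h0 : graphPoly G ∅ = 1 := by simp [graphPoly]
  rw [mul_one, h0, apolar_one, coeff_zero_one, mul_one] at h1
  -- Viewed through `rename`, `F` contains no vertex variable; this forces the exponents at the
  -- vertices to be 0.
  have h2 : edgeHom G F
      = aeval (fun z => ∑ v, C (incidence G v z) * X v) (rename Sum.inr F) := by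
    rw [aeval_rename]
    rfl
  rw [h2, ← apolar_aeval, apolar_eq_sum] at h1
  obtain ⟨K, hK, hne⟩ := exists_ne_zero_of_sum_ne_zero (h1.trans_ne hc)
  obtain ⟨α, rfl, hα⟩ := coeff_rename_ne_zero _ _ _ (mem_support_iff.mp hK)
  refine ⟨Finsupp.mapDomain Sum.inr α, fun v => ?_, fun e => ?_, ?_⟩
  · exact Finsupp.mapDomain_of_notMem_range _ _ (by simp)
  · rw [Finsupp.mapDomain_apply Sum.inr_injective]
    exact (monomial_le_degreeOf e (mem_support_iff.mpr hα)).trans (hF e)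
  · rw [← map_aeval_graphPoly, coeff_map, map_ne_zero]
    exact right_ne_zero_of_mul (right_ne_zero_of_mul hne)

end Final

end TotalWeight

theorem mainTheorem4 {V : Type*} [Fintype V] [LinearOrder V] (G : SimpleGraph V)
    [DecidableRel G.Adj] (hG : TotalWeight.IsNice G) :
    TotalWeight.AlgebraicChoosable G 1 6 := by
  obtain ⟨K, h1, h2, h3⟩ := (TotalWeight.deletes_all hG Finset.univ
    fun _ _ v _ => Finset.mem_univ v).exists_coeff_totalPoly_ne_zero
  refine ⟨K, ?_, fun v => ?_, fun e => ?_, h3⟩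
  · rw [← Finsupp.degree_eq_sum, Finsupp.degree_eq_weight_one]
    exact TotalWeight.isHomogeneous_totalPoly G h3
  · rw [h1]
    exact zero_lt_one
  · refine Nat.lt_succ_of_le ((h2 e).trans ?_)
    split_ifs <;> omega
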